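/- Conventions. Let $x:M^n\to\mathbb R^{n+1}$, $n\ge 1$, be a smooth hypersurface. In local coordinates $(u^i)$ of $M$ put $h_{ij}=\varepsilon\det(\partial_1x,\dots,\partial_nx,\partial_i\partial_jx)$, where $\varepsilon=\pm1$ is a choice of co-orientation, and $H=|\det(h_{ij})|$; $x$ is nondegenerate if $H\neq0$ everywhere. Its affine metric is $g_{ij}=H^{-1/(n+2)}h_{ij}$, its affine normal is $\xi=\frac1n\Delta_gx$, its affine connection $\nabla$ is given by $\partial_i\partial_jx=\sum_k\Gamma^k_{ij}\,\partial_kx+g_{ij}\,\xi$, and its Fubini–Pick form is $A=-\frac12\nabla g$. Denote by $\hat\nabla$ the Levi-Civita connection of $g$; $x$ is said to have parallel Fubini–Pick form if it is nondegenerate and $\hat\nabla A=0$ (this does not depend on $\varepsilon$). A nondegenerate $x$ is a hyperbolic affine hypersphere with affine center the origin if there is a constant $L_1<0$ such that, for a suitable local choice of the co-orientation, $d\xi=-L_1\,dx$, and every affine line $x(p)+\mathbb R\,\xi(p)$, $p\in M$, passes through the origin. A $0$-dimensional hyperbolic affine hypersphere is a smooth map from a $0$-dimensional manifold to $\mathbb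 R\setminus\{0\}$ (for a one-point manifold, a nonzero number); its Fubini–Pick form is parallel for trivial reasons. Proposition. Let $K\ge2$, let $n_1,\dots,n_K\ge0$ be integers, let $M_1,\dots,M_K$ be nonempty smooth manifolds of dimensions $n_1,\dots,n_K$, let $x_a:M_a\to\mathbb R^{n_a+1}$ $(1\le a\le K)$ be hyperbolic affine hyperspheres with the origin as their common affine center, and let $c_1,\dots,c_K>0$. Put $f_a=\sum_{b\le a}(n_b+1)$, $n=f_K-1$ and, for $t=(t_1,\dots,t_{K-1})\in\mathbb R^{K-1}$, $$e_a(t)=\exp\Big(-\frac{t_{a-1}}{n_a+1}+\sum_{\lambda=a}^{K-1}\frac{t_\lambda}{f_\lambda}\Big),$$ where the first term is absent for $a=1$. Let $x:\mathbb R^{K-1}\times M_1\times\cdots\times M_K\to\mathbb R^{n+1}$, $$x(t,p_1,\dots,p_K)=\big(c_1e_1(t)\,x_1(p_1),\dots,c_Ke_K(t)\,x_K(p_K)\big),$$ be the Calabi composition of $x_1,\dots,x_K$. Then $x$ has parallel Fubini–Pick form, with respect to the Levi-Civita connection of its affine metric, if and only if each factor $x_a$ has parallel Fubini–Pick form, with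 respect to the Levi-Civita connection of the affine metric of $x_a$. -/

import Mathlib

open scoped ContDiff Manifold

/-! ## Equiaffine invariants of a parametrised hypersurface

Throughout, `E` is an `n`-dimensional parameter space with linear coordinates given by a basis `b`
indexed by `ι` (so `n = Fintype.card ι`), and the ambient affine space is `κ → ℝ` with its standard
parallel volume.  The bijection `σ : κ ≃ Option ι` puts the `n` coordinate directions and the
transversal direction (`none`) in the order in which they enter a determinant.  The unit `ε = ± 1`
is the choice of a co-orientation: replacing `ε` by `-ε` changes the signs of the affine metric, of
the affine normal and of the Fubini-Pick form. -/

noncomputable section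

namespace EquiAffine

section Local

variable {E : Type*} [NormedAddCommGroup E] [NormedSpace ℝ E]
  {ι κ : Type*} [Fintype ι] [DecidableEq ι] [Fintype κ] [DecidableEq κ]

/-- The partial derivative `∂φ/∂uⁱ` in the linear coordinates of the basis `b`. -/
def pd {V : Type*} [NormedAddCommGroup V] [NormedSpace ℝ V]
    (b : Module.Basis ι ℝ E) (φ : E → V) (i : ι) (y : E) : V :=
  fderiv ℝ φ y (b i)

/-- The square matrix whose rows are the `v i` and `w`, in the order given by `σ`. -/
def frameMatrix (σ : κ ≃ Option ι) (v : ι → κ → ℝ) (w : κ → ℝ) : Matrix κ κ ℝ :=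
  Matrix.of fun r => (σ r).elim w v

/-- `h_{ij} = ε det(∂₁f, …, ∂ₙf, ∂ᵢ∂ⱼf)`. -/
def hForm (b : Module.Basis ι ℝ E) (σ : κ ≃ Option ι) (ε : ℤˣ) (f : E → κ → ℝ)
    (i j : ι) (y : E) : ℝ :=
  ((ε : ℤ) : ℝ) *
    (frameMatrix σ (fun l => pd b f l y) (pd b (fun z => pd b f j z) i y)).det

/-- `H = |det (h_{ij})|`. -/
def hDet (b : Module.Basis ι ℝ E) (σ : κ ≃ Option ι) (ε : ℤˣ) (f : E → κ → ℝ) (y : E) : ℝ :=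
  |(Matrix.of fun i j => hForm b σ ε f i j y).det|

/-- The affine (Berwald-Blaschke) metric `g_{ij} = H^{-1/(n+2)} h_{ij}`. -/
def affineMetric (b : Module.Basis ι ℝ E) (σ : κ ≃ Option ι) (ε : ℤˣ) (f : E → κ → ℝ)
    (i j : ι) (y : E) : ℝ :=
  hDet b σ ε f y ^ (-(1 / ((Fintype.card ι : ℝ) + 2))) * hForm b σ ε f i j y

/-- The inverse matrix `g^{ij}` of the affine metric. -/
def affineMetricInv (b : Module.Basis ι ℝ E) (σ : κ ≃ Option ι) (ε : ℤˣ) (f : E → κ → ℝ)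
    (i j : ι) (y : E) : ℝ :=
  (Matrix.of fun i' j' => affineMetric b σ ε f i' j' y)⁻¹ i j

/-- The Christoffel symbols (upper index `k`, lower indices `i`, `j`) of the Levi-Civita connection
of the affine metric. -/
def leviCivita (b : Module.Basis ι ℝ E) (σ : κ ≃ Option ι) (ε : ℤˣ) (f : E → κ → ℝ)
    (k i j : ι) (y : E) : ℝ :=
  (1 / 2) * ∑ l, affineMetricInv b σ ε f k l y *
    (pd b (fun z => affineMetric b σ ε f j l z) i y
      + pd b (fun z => affineMetric b σ ε f i l z) j y
      - pd b (fun z => affineMetric b σ ε f i j z) l y)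

/-- The affine normal `ξ = (1/n) Δ_g f`, where
`Δ_g f = ∑ g^{ij} (∂ᵢ∂ⱼf - ∑ Γ̂ᵏ_{ij} ∂ₖf)` is the Laplace-Beltrami operator of the affine
metric applied to the position vector. -/
def affineNormal (b : Module.Basis ι ℝ E) (σ : κ ≃ Option ι) (ε : ℤˣ) (f : E → κ → ℝ)
    (y : E) : κ → ℝ :=
  (1 / (Fintype.card ι : ℝ)) • ∑ i, ∑ j, affineMetricInv b σ ε f i j y •
    (pd b (fun z => pd b f j z) i y - ∑ k, leviCivita b σ ε f k i j y • pd b f k y)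

/-- The Christoffel symbols (upper index `k`, lower indices `i`, `j`) of the induced affine
connection `∇`: the coefficient of `∂ₖf` when `∂ᵢ∂ⱼf` is decomposed in the frame
`(∂₁f, …, ∂ₙf, ξ)`. -/
def affineConnection (b : Module.Basis ι ℝ E) (σ : κ ≃ Option ι) (ε : ℤˣ) (f : E → κ → ℝ)
    (k i j : ι) (y : E) : ℝ :=
  Matrix.vecMul (pd b (fun z => pd b f j z) i y)
    (frameMatrix σ (fun l => pd b f l y) (affineNormal b σ ε f y))⁻¹ (σ.symm (some k))

/-- The components `A_{ijk}` of the Fubini-Pick form `A = -(1/2) ∇g`, where `∇` is the induced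
affine connection and `g` is the affine metric. -/
def fubiniPick (b : Module.Basis ι ℝ E) (σ : κ ≃ Option ι) (ε : ℤˣ) (f : E → κ → ℝ)
    (i j k : ι) (y : E) : ℝ :=
  -(1 / 2) * (pd b (fun z => affineMetric b σ ε f i j z) k y
    - ∑ l, affineConnection b σ ε f l k i y * affineMetric b σ ε f l j y
    - ∑ l, affineConnection b σ ε f l k j y * affineMetric b σ ε f i l y)

/-- The components `A_{ijk,l}` of the covariant derivative of the Fubini-Pick form with respect to
the Levi-Civita connection of the affine metric. -/
def fubiniPickDeriv (b : Module.Basis ι ℝ E) (σ : κ ≃ Option ι) (ε : ℤˣ) (f : E → κ → ℝ)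
    (i j k l : ι) (y : E) : ℝ :=
  pd b (fun z => fubiniPick b σ ε f i j k z) l y
    - ∑ m, leviCivita b σ ε f m l i y * fubiniPick b σ ε f m j k y
    - ∑ m, leviCivita b σ ε f m l j y * fubiniPick b σ ε f i m k y
    - ∑ m, leviCivita b σ ε f m l k y * fubiniPick b σ ε f i j m y

end Local

/-! ## Hypersurfaces

A manifold `M` (without boundary) is modelled on `E` through `I`.  The invariants of a hypersurface
`x : M → (κ → ℝ)` are those of its local representations `x ∘ e⁻¹`, for `e` a chart of `M`. -/

section Global

variable {E : Type*} [NormedAddCommGroup E] [NormedSpace ℝ E]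
  {ι κ : Type*} [Fintype ι] [DecidableEq ι] [Fintype κ] [DecidableEq κ]
  {X : Type*} [TopologicalSpace X] (I : ModelWithCorners ℝ E X)
  (b : Module.Basis ι ℝ E) (σ : κ ≃ Option ι)
  {M : Type*} [TopologicalSpace M] [ChartedSpace X M]

/-- A smooth nondegenerate hypersurface: `det (h_{ij})` vanishes nowhere.  (At a point where the
differential of `x` is not injective, all `h_{ij}` vanish, so this includes that `x` is an
immersion.) -/
def IsNondegenerate (x : M → κ → ℝ) : Prop :=
  ContMDiff I 𝓘(ℝ, κ → ℝ) ∞ x ∧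
    ∀ e ∈ atlas X M, ∀ y ∈ (e.extend I).target,
      (Matrix.of fun i j => hForm b σ 1 (x ∘ (e.extend I).symm) i j y).det ≠ 0

/-- `x` is of parallel Fubini-Pick form with respect to the Levi-Civita connection of the affine
metric. -/
def HasParallelFubiniPick (x : M → κ → ℝ) : Prop :=
  IsNondegenerate I b σ x ∧
    ∀ e ∈ atlas X M, ∀ y ∈ (e.extend I).target, ∀ (ε : ℤˣ) (i j k l : ι),
      fubiniPickDeriv b σ ε (x ∘ (e.extend I).symm) i j k l y = 0

/-- `x` is an `n`-dimensional hyperbolic affine hypersphere with the origin as its affine center.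

For `n > 0`: there is a constant `L < 0` (the affine mean curvature) such that, near every point
and for a co-orientation there, the affine shape operator, given by `∂ᵢξ = -∂_{B(i)} f`, is
`L` times the identity, and the affine line through `f y` in the direction of the affine normal
passes through the origin.

For `n = 0`: `x` takes values in the line, away from the origin. -/
def IsHyperbolicAffineHypersphere (x : M → κ → ℝ) : Prop :=
  IsNondegenerate I b σ x ∧
    (0 < Fintype.card ι → ∃ L : ℝ, L < 0 ∧
      ∀ e ∈ atlas X M, ∀ y₀ ∈ (e.extend I).target, ∃ ε : ℤˣ, ∀ᶠ y in nhds y₀,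
        (∀ i, pd b (affineNormal b σ ε (x ∘ (e.extend I).symm)) i y
            = -(L • pd b (x ∘ (e.extend I).symm) i y)) ∧
        ∃ s : ℝ, (x ∘ (e.extend I).symm) y
            + s • affineNormal b σ ε (x ∘ (e.extend I).symm) y = 0) ∧
    (Fintype.card ι = 0 → ∀ p, x p ≠ 0)

end Global

/-- The standard basis of `ℝⁿ`. -/
def stdBasis (n : ℕ) : Module.Basis (Fin n) ℝ (EuclideanSpace ℝ (Fin n)) :=
  (EuclideanSpace.basisFun (Fin n) ℝ).toBasis

/-! ## The Calabi composition

There are `K = k + 1` factors `x_a : M_a → ℝ^{n_a + 1}`, indexed by `a : Fin (k + 1)`, that is, from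
`0` to `k`; accordingly the parameters `t` are indexed from `0` to `k - 1`. -/

section Calabi

variable {k : ℕ} (n : Fin (k + 1) → ℕ)

/-- `∑_{b ≤ l} (n_b + 1)`. -/
def partialDim (l : Fin k) : ℝ :=
  ∑ c ∈ Finset.Iic l.castSucc, ((n c : ℝ) + 1)

/-- The function `e_a` of `t`, the exponential of
`-t_{a-1} / (n_a + 1) + ∑_{l ≥ a} t_l / ∑_{b ≤ l} (n_b + 1)`, the first term being absent for
`a = 0`. -/
def calabiExp (a : Fin (k + 1)) (t : EuclideanSpace ℝ (Fin k)) : ℝ :=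
  Real.exp (∑ l : Fin k,
    if (l : ℕ) + 1 = a then -(t l / ((n a : ℝ) + 1))
    else if (a : ℕ) ≤ l then t l / partialDim n l
    else 0)

/-- The Calabi composition
`(t, p) ↦ (c_a e_a(t) x_a(p_a))_a ∈ ∏ ℝ^{n_a + 1} = ℝ^{n + 1}`, on `ℝ^{K-1} × ∏ M_a`. -/
def calabiComposition {M : Fin (k + 1) → Type*} (c : Fin (k + 1) → ℝ)
    (x : ∀ a, M a → Fin (n a + 1) → ℝ)
    (q : EuclideanSpace ℝ (Fin k) × (∀ a, M a)) : (Σ a, Fin (n a + 1)) → ℝ :=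
  fun r => c r.1 * calabiExp n r.1 q.1 * x r.1 (q.2 r.1) r.2

/-- The model with corners of the product manifold `ℝ^{K-1} × ∏ M_a`. -/
abbrev calabiModel :
    ModelWithCorners ℝ (EuclideanSpace ℝ (Fin k) × (∀ a, EuclideanSpace ℝ (Fin (n a))))
      (ModelProd (EuclideanSpace ℝ (Fin k)) (ModelPi fun a => EuclideanSpace ℝ (Fin (n a)))) :=
  (𝓡 k).prod (ModelWithCorners.pi fun a => 𝓡 (n a))

/-- The standard basis of `ℝ^{K-1} × ∏ ℝ^{n_a}`. -/
def calabiBasis : Module.Basis (Fin k ⊕ Σ a, Fin (n a)) ℝ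
    (EuclideanSpace ℝ (Fin k) × (∀ a, EuclideanSpace ℝ (Fin (n a)))) :=
  (stdBasis k).prod (Pi.basis fun a => stdBasis (n a))

/-- The dimension count `n + 1 = ∑ (n_a + 1)` with `n = K - 1 + ∑ n_a`. -/
theorem calabi_dim : ∑ a, (n a + 1) = (k + ∑ a, n a) + 1 := by
  simp [Finset.sum_add_distrib]; omega

/-- The lexicographic orders of the ambient coordinates, and of the coordinates of
`ℝ^{K-1} × ∏ ℝ^{n_a}` followed by the transversal direction, matched with each other. -/
def calabiOrder : (Σ a, Fin (n a + 1)) ≃ Option (Fin k ⊕ Σ a, Fin (n a)) :=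
  (finSigmaFinEquiv.trans (finCongr (calabi_dim n))).trans <|
    finSuccEquivLast.trans <|
      (((Equiv.refl (Fin k)).sumCongr finSigmaFinEquiv).trans finSumFinEquiv).symm.optionCongr

end Calabi

end EquiAffine

end

set_option linter.unusedSectionVars false

/-! For a hyperbolic affine hypersphere centered at the origin, the equation `dξ = -L dx` makes `ξ +
L x` locally constant, and since the affine normal lines pass through the origin this constant is
zero. Hence `ξ = -L x`, and the position vector itself is a transversal field. The affine structure
is therefore encoded in centroaffine data: `∂ᵢ∂ⱼf = ∑ Γᵏᵢⱼ ∂ₖf + Gᵢⱼ f`, where the volume of `G` is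
a constant multiple of the frame determinant and `Γ` is apolar (`CentroaffineSphereAt`,
`exists_centroaffineSphereAt`).

Conversely, such data determine the affine invariants up to constants. The affine metric is a
constant multiple of `G`, so the Levi-Civita connections agree, the affine normal is a constant
multiple of `f`, and the affine connection is `Γ`. Thus `∇̂A` is a nonzero constant times the
`G`-covariant derivative of `∇G` (`fubiniPickDeriv_eq`), and powers of determinants need not be
handled again.

The Calabi composition carries explicit data of the same kind (`calabi_centroaffineSphereAt`). Its
metric is a product of a constant diagonal metric in `t` and the metrics `w_a G_a`, where `w_a =
(n_a + 1)/(n + 1)`. The main algebraic input is that the constant function and the slope vectors of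
`log e_a` form an orthogonal basis for the weights `w_a`. Completeness of this basis
(`calabiDual_reproducing`) writes each block of the position vector in terms of `∂x/∂t` and `x`.

Sort the components of `∇G` by the number of `t` indices. With three, they are constant; with two,
they vanish; with one, they are `-2` times a slope times the weighted factor metrics, hence parallel
by metric compatibility; with none, they are the weighted cubic forms of the factors. For a product
metric the covariant derivative therefore reduces to those of the factors, each multiplied by a
positive weight (`covDeriv_calabi_eq_zero_iff`). This equivalence is pointwise in product charts,
which make up the atlas of the product. -/

namespace EquiAffine

/-! ### Linear algebra of a frame of tangent vectors and one transversal vector -/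

section Frame

variable {ι κ : Type*} [Fintype ι] [DecidableEq ι] [Fintype κ] [DecidableEq κ]

@[simp] theorem frameMatrix_symm_some (σ : κ ≃ Option ι) (v : ι → κ → ℝ) (w : κ → ℝ) (i : ι) :
    frameMatrix σ v w (σ.symm (some i)) = v i := by
  ext; simp [frameMatrix]

@[simp] theorem frameMatrix_symm_none (σ : κ ≃ Option ι) (v : ι → κ → ℝ) (w : κ → ℝ) :
    frameMatrix σ v w (σ.symm none) = w := by
  ext; simp [frameMatrix]

theorem sum_eq_frame (σ : κ ≃ Option ι) {V : Type*} [AddCommMonoid V] (F : κ → V) :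
    ∑ r, F r = ∑ i, F (σ.symm (some i)) + F (σ.symm none) := by
  rw [← σ.symm.sum_comp, Fintype.sum_option, add_comm]

theorem vecMul_frameMatrix (σ : κ ≃ Option ι) (v : ι → κ → ℝ) (w c : κ → ℝ) :
    Matrix.vecMul c (frameMatrix σ v w)
      = ∑ i, c (σ.symm (some i)) • v i + c (σ.symm none) • w := by
  rw [Matrix.vecMul_eq_sum, sum_eq_frame σ]
  simp

theorem frameMatrix_eq_updateRow (σ : κ ≃ Option ι) (v : ι → κ → ℝ) (w w' : κ → ℝ) :
    frameMatrix σ v w' = (frameMatrix σ v w).updateRow (σ.symm none) w' := by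
  ext r s
  rcases h : σ r with _ | i
  · obtain rfl : r = σ.symm none := by simp [← h]
    simp
  · obtain rfl : r = σ.symm (some i) := by simp [← h]
    rw [Matrix.updateRow_ne (by simp)]
    simp

/-- Row operations remove the tangential summands, so the determinant sees only the transversal
coefficient. -/
theorem det_frameMatrix_combination (σ : κ ≃ Option ι) (v : ι → κ → ℝ) (w : κ → ℝ)
    (a : ι → ℝ) (d : ℝ) :
    (frameMatrix σ v (∑ i, a i • v i + d • w)).det = d * (frameMatrix σ v w).det := by
  have h := Matrix.det_updateRow_sum (frameMatrix σ v w) (σ.symm none) fun r => (σ r).elim d a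
  rw [sum_eq_frame σ, ← frameMatrix_eq_updateRow] at h
  simpa using h

/-- The determinant of a frame as a linear function of the transversal vector. -/
noncomputable def frameDet (σ : κ ≃ Option ι) (v : ι → κ → ℝ) : (κ → ℝ) →ₗ[ℝ] ℝ :=
  (Matrix.detRowAlternating.toMultilinearMap).toLinearMap (frameMatrix σ v 0) (σ.symm none)

theorem frameDet_apply (σ : κ ≃ Option ι) (v : ι → κ → ℝ) (w : κ → ℝ) :
    frameDet σ v w = (frameMatrix σ v w).det := by
  rw [frameMatrix_eq_updateRow σ v 0 w]
  rfl

theorem frameDet_tangent (σ : κ ≃ Option ι) (v : ι → κ → ℝ) (i : ι) : frameDet σ v (v i) = 0 := by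
  rw [frameDet_apply]
  exact Matrix.det_zero_of_row_eq (i := σ.symm (some i)) (j := σ.symm none) (by simp) (by simp)

theorem frame_combination_eq_zero (σ : κ ≃ Option ι) {v : ι → κ → ℝ} {w : κ → ℝ}
    (hD : (frameMatrix σ v w).det ≠ 0) {a : ι → ℝ} {d : ℝ}
    (h : ∑ i, a i • v i + d • w = 0) : (∀ i, a i = 0) ∧ d = 0 := by
  have h' := Matrix.eq_zero_of_vecMul_eq_zero hD (v := fun r => (σ r).elim d a)
    (by rw [vecMul_frameMatrix]; simpa using h)
  exact ⟨fun i => by simpa using congrFun h' (σ.symm (some i)),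
    by simpa using congrFun h' (σ.symm none)⟩

/-- Right multiplication by the inverse frame matrix reads off coordinates in the frame; this is
what gives meaning to the definition of `affineConnection`. -/
theorem vecMul_inv_frameMatrix (σ : κ ≃ Option ι) {v : ι → κ → ℝ} {w : κ → ℝ}
    (hD : (frameMatrix σ v w).det ≠ 0) (a : ι → ℝ) (d : ℝ) (k : ι) :
    Matrix.vecMul (∑ i, a i • v i + d • w) (frameMatrix σ v w)⁻¹ (σ.symm (some k)) = a k := by
  have h := vecMul_frameMatrix σ v w fun r => (σ r).elim d a
  simp only [Equiv.apply_symm_apply, Option.elim] at h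
  rw [← h, Matrix.vecMul_vecMul, Matrix.mul_nonsing_inv _ (isUnit_iff_ne_zero.mpr hD)]
  simp

theorem eq_combination_frame (σ : κ ≃ Option ι) {v : ι → κ → ℝ} {w : κ → ℝ}
    (hD : (frameMatrix σ v w).det ≠ 0) (u : κ → ℝ) :
    ∃ d : ℝ, u = ∑ k, Matrix.vecMul u (frameMatrix σ v w)⁻¹ (σ.symm (some k)) • v k + d • w := by
  refine ⟨Matrix.vecMul u (frameMatrix σ v w)⁻¹ (σ.symm none), ?_⟩
  rw [← vecMul_frameMatrix, Matrix.vecMul_vecMul,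
    Matrix.nonsing_inv_mul _ (isUnit_iff_ne_zero.mpr hD), Matrix.vecMul_one]

end Frame

/-! ### Partial derivatives -/

section PartialDerivative

variable {E : Type*} [NormedAddCommGroup E] [NormedSpace ℝ E] {ι : Type*}
  {V : Type*} [NormedAddCommGroup V] [NormedSpace ℝ V]

theorem pd_congr (b : Module.Basis ι ℝ E) {φ ψ : E → V} {y : E} (h : φ =ᶠ[nhds y] ψ) (i : ι) :
    pd b φ i y = pd b ψ i y := by
  rw [pd, pd, h.fderiv_eq]

theorem eventually_pd_eq (b : Module.Basis ι ℝ E) {φ ψ : E → V} {y : E}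
    (h : ∀ᶠ z in nhds y, φ z = ψ z) : ∀ᶠ z in nhds y, ∀ i, pd b φ i z = pd b ψ i z :=
  h.eventually_nhds.mono fun _ hz i => pd_congr b hz i

/-- No differentiability is needed, because over a field a nonzero scalar preserves
non-differentiability too. Centroaffine data can therefore be used without any smoothness of `G` or
`Γ`. -/
theorem pd_const_mul (b : Module.Basis ι ℝ E) (c : ℝ) (φ : E → ℝ) (i : ι) (y : E) :
    pd b (fun z => c * φ z) i y = c * pd b φ i y := by
  have h : (fun z => c * φ z) = c • φ := rfl
  rw [pd, pd, h, fderiv_const_smul_field]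
  simp

@[simp] theorem pd_const (b : Module.Basis ι ℝ E) (c : V) (i : ι) (y : E) :
    pd b (fun _ => c) i y = 0 := by
  simp [pd]

end PartialDerivative

/-! ### Christoffel symbols, cubic form and covariant derivative of abstract data -/

section Tensor

variable {E : Type*} [NormedAddCommGroup E] [NormedSpace ℝ E] {ι : Type*} [Fintype ι]
  [DecidableEq ι]

/-- The Christoffel symbols of the metric `G`. -/
noncomputable def christoffel (b : Module.Basis ι ℝ E) (G : ι → ι → E → ℝ) (k i j : ι) (y : E) :
    ℝ :=
  (1 / 2) * ∑ l, (Matrix.of fun i' j' => G i' j' y)⁻¹ k l *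
    (pd b (fun z => G j l z) i y + pd b (fun z => G i l z) j y - pd b (fun z => G i j z) l y)

/-- The components `(∇G)_{ijk}`, where `∇` has the Christoffel symbols `Γ`. -/
noncomputable def cubicForm (b : Module.Basis ι ℝ E) (G : ι → ι → E → ℝ) (Γ : ι → ι → ι → E → ℝ)
    (i j k : ι) (y : E) : ℝ :=
  pd b (fun z => G i j z) k y - ∑ l, Γ l k i y * G l j y - ∑ l, Γ l k j y * G i l y

/-- The covariant derivative of a cubic form with respect to the Levi-Civita connection of `G`. -/
noncomputable def covDeriv (b : Module.Basis ι ℝ E) (G : ι → ι → E → ℝ)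
    (C : ι → ι → ι → E → ℝ) (i j k l : ι) (y : E) : ℝ :=
  pd b (fun z => C i j k z) l y
    - ∑ m, christoffel b G m l i y * C m j k y
    - ∑ m, christoffel b G m l j y * C i m k y
    - ∑ m, christoffel b G m l k y * C i j m y

end Tensor

/-! ### From centroaffine data to the equiaffine invariants -/

section Centroaffine

variable {E : Type*} [NormedAddCommGroup E] [NormedSpace ℝ E]
  {ι κ : Type*} [Fintype ι] [DecidableEq ι] [Fintype κ] [DecidableEq κ]

/-- At the point `z`, the position vector of `f` is transversal, with structure equations
`∂ᵢ∂ⱼf = ∑ Γᵏ_{ij} ∂ₖf + G_{ij} f`, the volume form of `G` is proportional to the one induced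
by the position vector (`s` fixes an orientation), and `Γ` is apolar with respect to `G`. -/
structure CentroaffineSphereAt (b : Module.Basis ι ℝ E) (σ : κ ≃ Option ι) (f : E → κ → ℝ)
    (G : ι → ι → E → ℝ) (Γ : ι → ι → ι → E → ℝ) (C s : ℝ) (z : E) : Prop where
  gauss : ∀ i j, pd b (fun y => pd b f j y) i z = ∑ k, Γ k i j z • pd b f k z + G i j z • f z
  pos : 0 < s * (frameMatrix σ (fun l => pd b f l z) (f z)).det
  vol : |(Matrix.of fun i j => G i j z).det|
    = C * (frameMatrix σ (fun l => pd b f l z) (f z)).det ^ 2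
  symm : ∀ i j, G i j z = G j i z
  apolar : ∀ k, ∑ i, ∑ j, (Matrix.of fun i' j' => G i' j' z)⁻¹ i j *
    (Γ k i j z - christoffel b G k i j z) = 0

namespace CentroaffineSphereAt

variable {b : Module.Basis ι ℝ E} {σ : κ ≃ Option ι} {f : E → κ → ℝ}
  {G : ι → ι → E → ℝ} {Γ : ι → ι → ι → E → ℝ} {C s : ℝ} {z : E}

theorem det_frame_ne_zero (h : CentroaffineSphereAt b σ f G Γ C s z) :
    (frameMatrix σ (fun l => pd b f l z) (f z)).det ≠ 0 := by
  intro h0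
  have := h.pos
  simp [h0] at this

theorem det_metric_ne_zero (hC : 0 < C) (h : CentroaffineSphereAt b σ f G Γ C s z) :
    (Matrix.of fun i j => G i j z).det ≠ 0 := by
  have h1 := h.det_frame_ne_zero
  rw [← abs_pos, h.vol]
  positivity

theorem hForm_eq (h : CentroaffineSphereAt b σ f G Γ C s z) (ε : ℤˣ) (i j : ι) :
    hForm b σ ε f i j z
      = (((ε : ℤ) : ℝ) * (frameMatrix σ (fun l => pd b f l z) (f z)).det) * G i j z := by
  rw [hForm, h.gauss, det_frameMatrix_combination]
  ring

theorem det_hForm_eq (h : CentroaffineSphereAt b σ f G Γ C s z) (ε : ℤˣ) :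
    (Matrix.of fun i j => hForm b σ ε f i j z).det
      = (((ε : ℤ) : ℝ) * (frameMatrix σ (fun l => pd b f l z) (f z)).det) ^ Fintype.card ι *
        (Matrix.of fun i j => G i j z).det := by
  rw [← Matrix.det_smul]
  congr 1
  ext i j
  simp [h.hForm_eq]

theorem det_hForm_ne_zero (hC : 0 < C) (h : CentroaffineSphereAt b σ f G Γ C s z) (ε : ℤˣ) :
    (Matrix.of fun i j => hForm b σ ε f i j z).det ≠ 0 := by
  rw [h.det_hForm_eq]
  have h0 : ((ε : ℤ) : ℝ) ≠ 0 := by exact_mod_cast ε.ne_zero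
  exact mul_ne_zero (pow_ne_zero _ (mul_ne_zero h0 h.det_frame_ne_zero)) (h.det_metric_ne_zero hC)

theorem abs_units (ε : ℤˣ) : |((ε : ℤ) : ℝ)| = 1 := by
  rcases Int.units_eq_one_or ε with rfl | rfl <;> simp

/-- With `D` the frame determinant, `h = ε D G` and `H = |D|ⁿ · C D² = C |D|ⁿ⁺²`. Hence
`H^{-1/(n+2)}` cancels `|D|`, and only the sign of `D` survives, which is fixed by `s`. The fields
`vol` and `pos` serve to make this factor independent of the point. -/
theorem affineMetric_eq (hC : 0 < C) (h : CentroaffineSphereAt b σ f G Γ C s z) (ε : ℤˣ)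
    (i j : ι) :
    affineMetric b σ ε f i j z
      = (C ^ (-(1 / ((Fintype.card ι : ℝ) + 2))) * ((ε : ℤ) : ℝ) * (s / |s|)) * G i j z := by
  set D := (frameMatrix σ (fun l => pd b f l z) (f z)).det with hD
  have hD0 : D ≠ 0 := h.det_frame_ne_zero
  have hH : hDet b σ ε f z = C * |D| ^ ((Fintype.card ι : ℝ) + 2) := by
    rw [hDet, h.det_hForm_eq, abs_mul, abs_pow, abs_mul, abs_units, h.vol, ← hD, one_mul,
      ← sq_abs D, Real.rpow_add (abs_pos.mpr hD0), Real.rpow_natCast, Real.rpow_two]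
    ring
  rw [affineMetric, h.hForm_eq, hH, Real.mul_rpow hC.le (by positivity),
    ← Real.rpow_mul (abs_nonneg D), ← hD]
  have h2 : ((Fintype.card ι : ℝ) + 2) * -(1 / ((Fintype.card ι : ℝ) + 2)) = -1 := by
    have : ((Fintype.card ι : ℝ) + 2) ≠ 0 := by positivity
    field_simp
  rw [h2, Real.rpow_neg_one]
  have h3 : |D|⁻¹ * D = s / |s| := by
    rcases mul_pos_iff.mp h.pos with ⟨hs, hD'⟩ | ⟨hs, hD'⟩
    · rw [abs_of_pos hs, abs_of_pos hD', div_self hs.ne', inv_mul_cancel₀ hD0]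
    · rw [abs_of_neg hs, abs_of_neg hD', div_neg, div_self hs.ne, inv_neg, neg_mul,
        inv_mul_cancel₀ hD0]
  linear_combination (C ^ (-(1 / ((Fintype.card ι : ℝ) + 2))) * ((ε : ℤ) : ℝ) * G i j z) * h3


end CentroaffineSphereAt

/-- The factor `θ` in the derivatives cancels against `θ⁻¹` in the inverse metric. -/
theorem christoffel_const_mul {b : Module.Basis ι ℝ E} {G G' : ι → ι → E → ℝ} {θ : ℝ} (hθ : θ ≠ 0)
    {z : E} (hG : ∀ i j, G' i j z = θ * G i j z)
    (hdet : (Matrix.of fun i j => G i j z).det ≠ 0)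
    (hpd : ∀ i j k, pd b (fun y => G' i j y) k z = θ * pd b (fun y => G i j y) k z) (k i j : ι) :
    christoffel b G' k i j z = christoffel b G k i j z := by
  have hm : (Matrix.of fun i j => G' i j z) = (Units.mk0 θ hθ) • (Matrix.of fun i j => G i j z) := by
    ext i j; simp [hG, Units.smul_def]
  rw [christoffel, christoffel, hm, Matrix.inv_smul' _ _ (isUnit_iff_ne_zero.mpr hdet)]
  congr 1
  refine Finset.sum_congr rfl fun l _ => ?_
  simp only [hpd, Matrix.smul_apply, Units.smul_def, Units.val_inv_eq_inv_val, Units.val_mk0,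
    smul_eq_mul]
  field_simp

theorem sum_inv_mul_self {G : Matrix ι ι ℝ} (hdet : G.det ≠ 0) (hs : ∀ i j, G i j = G j i) :
    ∑ i, ∑ j, G⁻¹ i j * G i j = Fintype.card ι := by
  have h : ∀ i, ∑ j, G⁻¹ i j * G i j = 1 := by
    intro i
    have := congrFun (congrFun (Matrix.nonsing_inv_mul G (isUnit_iff_ne_zero.mpr hdet)) i) i
    rw [Matrix.mul_apply, Matrix.one_apply_eq] at this
    rw [← this]
    exact Finset.sum_congr rfl fun j _ => by rw [hs i j]
  simp [h]

section Invariants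

variable {b : Module.Basis ι ℝ E} {σ : κ ≃ Option ι} {f : E → κ → ℝ}
  {G : ι → ι → E → ℝ} {Γ : ι → ι → ι → E → ℝ} {C s : ℝ} {y z : E} {ε : ℤˣ} {θ : ℝ}

/-- The transversal vector `w` is arbitrary so that the formula serves in both directions: with `w =
f` it computes the affine normal, and with `w = ξ` it yields apolarity. -/
theorem affineNormal_expand {Γ : ι → ι → ι → ℝ} {g : ι → ι → ℝ} {w : κ → ℝ}
    (h : ∀ i j, pd b (fun y => pd b f j y) i z = ∑ k, Γ k i j • pd b f k z + g i j • w) :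
    affineNormal b σ ε f z = (1 / (Fintype.card ι : ℝ)) •
      (∑ k, (∑ i, ∑ j, affineMetricInv b σ ε f i j z * (Γ k i j - leviCivita b σ ε f k i j z)) •
        pd b f k z + (∑ i, ∑ j, affineMetricInv b σ ε f i j z * g i j) • w) := by
  have term : ∀ i j, affineMetricInv b σ ε f i j z •
      (pd b (fun z => pd b f j z) i z - ∑ k, leviCivita b σ ε f k i j z • pd b f k z)
      = ∑ k, (affineMetricInv b σ ε f i j z * (Γ k i j - leviCivita b σ ε f k i j z)) • pd b f k z
        + (affineMetricInv b σ ε f i j z * g i j) • w := by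
    intro i j
    rw [h, add_sub_right_comm, ← Finset.sum_sub_distrib, smul_add, Finset.smul_sum, smul_smul]
    simp only [← sub_smul, smul_smul]
  rw [affineNormal]
  simp only [term, Finset.sum_add_distrib, Finset.sum_smul]
  congr 2
  rw [Finset.sum_congr rfl fun i _ => Finset.sum_comm, Finset.sum_comm]

/-- Apolarity removes the tangential part of the Laplacian. The trace of `G` with respect to `θ G`
is `n θ⁻¹`, and the normalisation `1/n` leaves `θ⁻¹`. -/
theorem affineNormal_eq_smul (hι : 0 < Fintype.card ι) (hC : 0 < C)
    (h : CentroaffineSphereAt b σ f G Γ C s z) (hθ : θ ≠ 0)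
    (hG : ∀ i j, affineMetric b σ ε f i j z = θ * G i j z)
    (hΓ : ∀ k i j, leviCivita b σ ε f k i j z = christoffel b G k i j z) :
    affineNormal b σ ε f z = θ⁻¹ • f z := by
  have hdet := h.det_metric_ne_zero hC
  have hm : (Matrix.of fun i j => affineMetric b σ ε f i j z)
      = (Units.mk0 θ hθ) • (Matrix.of fun i j => G i j z) := by
    ext i j; simp [hG, Units.smul_def]
  have hinv : ∀ i j, affineMetricInv b σ ε f i j z
      = θ⁻¹ * (Matrix.of fun i j => G i j z)⁻¹ i j := by
    intro i j
    rw [affineMetricInv, hm, Matrix.inv_smul' _ _ (isUnit_iff_ne_zero.mpr hdet)]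
    simp [Units.smul_def]
  have hap := h.apolar
  have htr := sum_inv_mul_self hdet (fun i j => h.symm i j)
  generalize (Matrix.of fun i j => G i j z)⁻¹ = W at hinv hap htr
  rw [affineNormal_expand h.gauss]
  simp only [hinv, hΓ, mul_assoc, ← Finset.mul_sum, hap, mul_zero, zero_smul,
    Finset.sum_const_zero, zero_add]
  simp only [Matrix.of_apply] at htr
  rw [htr, smul_smul]
  congr 1
  have : (Fintype.card ι : ℝ) ≠ 0 := by positivity
  field_simp

/-- Rescaling the transversal vector rescales the transversal coefficient and leaves the tangential
ones unchanged. -/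
theorem affineConnection_eq (h : CentroaffineSphereAt b σ f G Γ C s z) (hθ : θ ≠ 0)
    (hξ : affineNormal b σ ε f z = θ⁻¹ • f z) (k i j : ι) :
    affineConnection b σ ε f k i j z = Γ k i j z := by
  have hD : (frameMatrix σ (fun l => pd b f l z) (affineNormal b σ ε f z)).det ≠ 0 := by
    have := det_frameMatrix_combination σ (fun l => pd b f l z) (f z) 0 θ⁻¹
    simp only [Pi.zero_apply, zero_smul, Finset.sum_const_zero, zero_add] at this
    rw [hξ, this]
    exact mul_ne_zero (inv_ne_zero hθ) h.det_frame_ne_zero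
  have hg : pd b (fun y => pd b f j y) i z
      = ∑ k, Γ k i j z • pd b f k z + (θ * G i j z) • affineNormal b σ ε f z := by
    rw [h.gauss, hξ, smul_smul]
    congr 2
    field_simp
  rw [affineConnection, hg, vecMul_inv_frameMatrix σ hD]

/-- The covariant derivative of the Fubini-Pick form in terms of centroaffine data. -/
theorem fubiniPickDeriv_eq (hC : 0 < C) (h : ∀ᶠ z in nhds y, CentroaffineSphereAt b σ f G Γ C s z)
    (ε : ℤˣ) : ∃ θ : ℝ, θ ≠ 0 ∧ ∀ i j k l, fubiniPickDeriv b σ ε f i j k l y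
      = θ * covDeriv b G (cubicForm b G Γ) i j k l y := by
  -- In dimension zero there are no components, and the factor `1/n` in the affine normal is
  -- meaningless.
  rcases isEmpty_or_nonempty ι with hι | hι
  · exact ⟨1, one_ne_zero, fun i => isEmptyElim i⟩
  set θ := C ^ (-(1 / ((Fintype.card ι : ℝ) + 2))) * ((ε : ℤ) : ℝ) * (s / |s|) with hθdef
  have hs : s ≠ 0 := by
    have := h.self_of_nhds.pos
    rintro rfl
    simp at this
  have hθ : θ ≠ 0 := by
    have h1 : ((ε : ℤ) : ℝ) ≠ 0 := by exact_mod_cast ε.ne_zero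
    have h2 := (Real.rpow_pos_of_pos hC (-(1 / ((Fintype.card ι : ℝ) + 2)))).ne'
    have h3 := abs_ne_zero.mpr hs
    positivity
  have hG : ∀ᶠ z in nhds y, ∀ i j, affineMetric b σ ε f i j z = θ * G i j z :=
    h.mono fun z hz i j => hz.affineMetric_eq hC ε i j
  have hpd : ∀ᶠ z in nhds y, ∀ i j k,
      pd b (fun y => affineMetric b σ ε f i j y) k z = θ * pd b (fun y => G i j y) k z := by
    simp only [Filter.eventually_all] at hG ⊢
    intro i j k
    filter_upwards [eventually_pd_eq b (hG i j)] with z hz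
    rw [hz, pd_const_mul]
  have hΓ : ∀ᶠ z in nhds y, ∀ k i j,
      leviCivita b σ ε f k i j z = christoffel b G k i j z := by
    filter_upwards [h, hG, hpd] with z h1 h2 h3
    exact christoffel_const_mul hθ h2 (h1.det_metric_ne_zero hC) h3
  have hconn : ∀ᶠ z in nhds y, ∀ k i j, affineConnection b σ ε f k i j z = Γ k i j z := by
    filter_upwards [h, hG, hΓ] with z h1 h2 h3
    exact affineConnection_eq h1 hθ (affineNormal_eq_smul Fintype.card_pos hC h1 hθ h2 h3)
  have hA : ∀ᶠ z in nhds y, ∀ i j k,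
      fubiniPick b σ ε f i j k z = (-(1 / 2) * θ) * cubicForm b G Γ i j k z := by
    filter_upwards [hG, hpd, hconn] with z h2 h3 h4 i j k
    rw [fubiniPick, cubicForm, h3]
    simp only [h2, h4, mul_sub, Finset.mul_sum]
    congr 1
    · congr 1
      · ring
      · exact Finset.sum_congr rfl fun l _ => by ring
    · exact Finset.sum_congr rfl fun l _ => by ring
  refine ⟨-(1 / 2) * θ, mul_ne_zero (by norm_num) hθ, fun i j k l => ?_⟩
  have hA' : pd b (fun z => fubiniPick b σ ε f i j k z) l y
      = (-(1 / 2) * θ) * pd b (fun z => cubicForm b G Γ i j k z) l y := by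
    rw [← pd_const_mul]
    exact pd_congr b (hA.mono fun z hz => hz i j k) l
  rw [fubiniPickDeriv, covDeriv, hA']
  simp only [hA.self_of_nhds, hΓ.self_of_nhds, mul_sub, Finset.mul_sum]
  congr 1
  · congr 1
    · congr 1
      exact Finset.sum_congr rfl fun l _ => by ring
    · exact Finset.sum_congr rfl fun l _ => by ring
  · exact Finset.sum_congr rfl fun l _ => by ring

end Invariants

end Centroaffine

/-! ### From a hyperbolic affine hypersphere to centroaffine data -/

section Hypersphere

variable {E : Type*} [NormedAddCommGroup E] [NormedSpace ℝ E]
  {ι κ : Type*} [Fintype ι] [DecidableEq ι] [Fintype κ] [DecidableEq κ]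
  {b : Module.Basis ι ℝ E} {σ : κ ≃ Option ι} {f : E → κ → ℝ} {y z : E} {ε : ℤˣ}

theorem pd_pd_comm {V : Type*} [NormedAddCommGroup V] [NormedSpace ℝ V] {f : E → V}
    (hf : ContDiffAt ℝ ∞ f z) (i j : ι) :
    pd b (fun y => pd b f j y) i z = pd b (fun y => pd b f i y) j z := by
  have hd : DifferentiableAt ℝ (fderiv ℝ f) z :=
    (hf.fderiv_right (m := 1) (by norm_cast)).differentiableAt one_ne_zero
  have h : ∀ i j, pd b (fun y => pd b f j y) i z = fderiv ℝ (fderiv ℝ f) z (b i) (b j) := by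
    intro i j
    change fderiv ℝ (fun y => fderiv ℝ f y (b j)) z (b i) = _
    rw [fderiv_clm_apply hd (differentiableAt_const _)]
    simp
  rw [h, h]
  exact hf.isSymmSndFDerivAt (by simpa using WithTop.coe_le_coe.mpr (le_top : (2 : ℕ∞) ≤ ⊤)) _ _

theorem hForm_eq_mul_one (ε : ℤˣ) (i j : ι) :
    hForm b σ ε f i j z = ((ε : ℤ) : ℝ) * hForm b σ 1 f i j z := by
  simp [hForm]

theorem det_hForm_ne_zero_of_one (h : (Matrix.of fun i j => hForm b σ 1 f i j z).det ≠ 0)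
    (ε : ℤˣ) : (Matrix.of fun i j => hForm b σ ε f i j z).det ≠ 0 := by
  have : (Matrix.of fun i j => hForm b σ ε f i j z)
      = ((ε : ℤ) : ℝ) • Matrix.of fun i j => hForm b σ 1 f i j z := by
    ext i j; simp [hForm_eq_mul_one ε]
  rw [this, Matrix.det_smul]
  exact mul_ne_zero (pow_ne_zero _ (by exact_mod_cast ε.ne_zero)) h

theorem units_mul_self (ε : ℤˣ) : ((ε : ℤ) : ℝ) * ((ε : ℤ) : ℝ) = 1 := by
  rcases Int.units_eq_one_or ε with rfl | rfl <;> simp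

theorem frameDet_pd (i : ι) : frameDet σ (fun l => pd b f l z) (pd b f i z) = 0 :=
  frameDet_tangent σ (fun l => pd b f l z) i

theorem frameDet_pd_pd (ε : ℤˣ) (i j : ι) :
    frameDet σ (fun l => pd b f l z) (pd b (fun y => pd b f j y) i z)
      = ((ε : ℤ) : ℝ) * hForm b σ ε f i j z := by
  rw [frameDet_apply, hForm, ← mul_assoc, units_mul_self, one_mul]

theorem hForm_eq_rpow_mul (hH : 0 < hDet b σ ε f z) (i j : ι) :
    hForm b σ ε f i j z
      = hDet b σ ε f z ^ (1 / ((Fintype.card ι : ℝ) + 2)) * affineMetric b σ ε f i j z := by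
  rw [affineMetric, ← mul_assoc, ← Real.rpow_add hH]
  simp

theorem det_affineMetric (ε : ℤˣ) : (Matrix.of fun i j => affineMetric b σ ε f i j z).det
    = (hDet b σ ε f z ^ (-(1 / ((Fintype.card ι : ℝ) + 2)))) ^ Fintype.card ι
      * (Matrix.of fun i j => hForm b σ ε f i j z).det := by
  rw [← Matrix.det_smul]
  congr 1

/-- The affine normal is transversal. -/
theorem frameDet_affineNormal (hι : 0 < Fintype.card ι)
    (hdet : (Matrix.of fun i j => hForm b σ ε f i j z).det ≠ 0)
    (hsymm : ∀ i j, pd b (fun y => pd b f j y) i z = pd b (fun y => pd b f i y) j z) :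
    frameDet σ (fun l => pd b f l z) (affineNormal b σ ε f z)
      = ((ε : ℤ) : ℝ) * hDet b σ ε f z ^ (1 / ((Fintype.card ι : ℝ) + 2)) := by
  have hH : 0 < hDet b σ ε f z := abs_pos.mpr hdet
  have hg : (Matrix.of fun i j => affineMetric b σ ε f i j z).det ≠ 0 := by
    rw [det_affineMetric]
    exact mul_ne_zero (pow_ne_zero _ (Real.rpow_pos_of_pos hH _).ne') hdet
  have htr := sum_inv_mul_self hg (fun i j => by simp [affineMetric, hForm, hsymm i j])
  simp only [affineNormal, map_smul, map_sum, map_sub, frameDet_pd, mul_zero,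
    Finset.sum_const_zero, sub_zero, frameDet_pd_pd ε, hForm_eq_rpow_mul hH, smul_eq_mul]
  have : ∀ i j, affineMetricInv b σ ε f i j z * (((ε : ℤ) : ℝ) *
      (hDet b σ ε f z ^ (1 / ((Fintype.card ι : ℝ) + 2)) * affineMetric b σ ε f i j z))
      = (((ε : ℤ) : ℝ) * hDet b σ ε f z ^ (1 / ((Fintype.card ι : ℝ) + 2))) *
        ((Matrix.of fun i j => affineMetric b σ ε f i j z)⁻¹ i j *
          (Matrix.of fun i j => affineMetric b σ ε f i j z) i j) := by
    intro i j
    rw [affineMetricInv, Matrix.of_apply]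
    ring
  simp only [this, ← Finset.mul_sum, htr]
  have : (Fintype.card ι : ℝ) ≠ 0 := by positivity
  field_simp

theorem frameDet_affineNormal_ne_zero (hι : 0 < Fintype.card ι)
    (hdet : (Matrix.of fun i j => hForm b σ ε f i j z).det ≠ 0)
    (hsymm : ∀ i j, pd b (fun y => pd b f j y) i z = pd b (fun y => pd b f i y) j z) :
    frameDet σ (fun l => pd b f l z) (affineNormal b σ ε f z) ≠ 0 := by
  rw [frameDet_affineNormal hι hdet hsymm]
  exact mul_ne_zero (by exact_mod_cast ε.ne_zero)
    (Real.rpow_pos_of_pos (abs_pos.mpr hdet) _).ne'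

/-- The frame determinant kills tangent vectors. Applying it to the decomposition of `∂ᵢ∂ⱼf` in the
affine frame identifies the transversal coefficient as `hᵢⱼ / H^{1/(n+2)}`. -/
theorem gauss_affine (hι : 0 < Fintype.card ι)
    (hdet : (Matrix.of fun i j => hForm b σ ε f i j z).det ≠ 0)
    (hsymm : ∀ i j, pd b (fun y => pd b f j y) i z = pd b (fun y => pd b f i y) j z) (i j : ι) :
    pd b (fun y => pd b f j y) i z = ∑ k, affineConnection b σ ε f k i j z • pd b f k z
      + affineMetric b σ ε f i j z • affineNormal b σ ε f z := by
  have hD := frameDet_affineNormal_ne_zero hι hdet hsymm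
  have hH : 0 < hDet b σ ε f z := abs_pos.mpr hdet
  obtain ⟨d, hd⟩ := eq_combination_frame σ (by rwa [frameDet_apply] at hD)
    (pd b (fun y => pd b f j y) i z)
  have h2 := congrArg (frameDet σ fun l => pd b f l z) hd
  rw [frameDet_pd_pd ε, map_add, map_sum, map_smul, frameDet_affineNormal hι hdet hsymm,
    hForm_eq_rpow_mul hH] at h2
  simp only [map_smul, frameDet_pd, mul_zero, Finset.sum_const_zero, zero_add,
    smul_eq_mul] at h2
  have h3 : ((ε : ℤ) : ℝ) * hDet b σ ε f z ^ (1 / ((Fintype.card ι : ℝ) + 2)) ≠ 0 :=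
    mul_ne_zero (by exact_mod_cast ε.ne_zero) (Real.rpow_pos_of_pos hH _).ne'
  have h4 : d = affineMetric b σ ε f i j z := by
    apply mul_right_cancel₀ h3
    linarith
  rw [h4] at hd
  exact hd

/-- The affine normal of a proper affine hypersphere centred at the origin is a multiple of the
position vector. -/
theorem affineNormal_eq_of_hypersphere (hι : 0 < Fintype.card ι)
    (hf : ∀ᶠ z in nhds y, ContDiffAt ℝ ∞ f z)
    (hdet : ∀ᶠ z in nhds y, (Matrix.of fun i j => hForm b σ 1 f i j z).det ≠ 0) {L : ℝ}
    (hL : L < 0)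
    (h : ∀ᶠ z in nhds y, (∀ i, pd b (affineNormal b σ ε f) i z = -(L • pd b f i z)) ∧
      ∃ s : ℝ, f z + s • affineNormal b σ ε f z = 0) :
    ∀ᶠ z in nhds y, affineNormal b σ ε f z = -L • f z := by
  obtain ⟨i₀⟩ : Nonempty ι := Fintype.card_pos_iff.mp hι
  have htrans : ∀ᶠ z in nhds y,
      frameDet σ (fun l => pd b f l z) (affineNormal b σ ε f z) ≠ 0 := by
    filter_upwards [hf, hdet] with z h1 h2
    exact frameDet_affineNormal_ne_zero hι (det_hForm_ne_zero_of_one h2 ε)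
      (fun i j => pd_pd_comm h1 i j)
  have hindep : ∀ᶠ z in nhds y, ∀ p q : ℝ,
      p • pd b f i₀ z + q • affineNormal b σ ε f z = 0 → p = 0 ∧ q = 0 := by
    filter_upwards [htrans] with z hz p q hpq
    rw [frameDet_apply] at hz
    have := frame_combination_eq_zero σ hz (a := Pi.single i₀ p) (d := q)
      (by rw [← hpq]; simp [Pi.single_apply, ite_smul])
    exact ⟨by simpa using this.1 i₀, this.2⟩
  have hdiff : ∀ᶠ z in nhds y, DifferentiableAt ℝ (affineNormal b σ ε f) z := by
    filter_upwards [h, hindep] with z h1 h2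
    -- Differentiability of `ξ` comes from the shape equation: otherwise its derivative has the
    -- default value `0`, which forces `L ∂f = 0`, against `L < 0` and the independence of `∂f`.
    by_contra hn
    have h3 := h1.1 i₀
    rw [pd, fderiv_zero_of_not_differentiableAt hn] at h3
    have := (h2 (-L) 0 (by simpa using h3.symm)).1
    linarith
  have hzero : ∀ᶠ z in nhds y, HasFDerivAt (fun z => affineNormal b σ ε f z + L • f z)
      (0 : E →L[ℝ] κ → ℝ) z := by
    filter_upwards [h, hdiff, hf] with z h1 h2 h3
    have hfd := (h3.differentiableAt (by simp)).hasFDerivAt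
    have hadd := h2.hasFDerivAt.add (hfd.const_smul L)
    have h0 : fderiv ℝ (affineNormal b σ ε f) z + L • fderiv ℝ f z = 0 := by
      refine ContinuousLinearMap.coe_injective (b.ext fun i => ?_)
      have := h1.1 i
      rw [pd, pd] at this
      simp [this]
    rw [h0] at hadd
    exact hadd
  obtain ⟨r, hr, hball⟩ := Metric.eventually_nhds_iff_ball.mp hzero
  have hconst : ∀ z ∈ Metric.ball y r, affineNormal b σ ε f z + L • f z
      = affineNormal b σ ε f y + L • f y := fun z hz =>
    (convex_ball y r).is_const_of_fderivWithin_eq_zero (𝕜 := ℝ)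
      (f := fun z => affineNormal b σ ε f z + L • f z)
      (fun w hw => (hball w hw).differentiableAt.differentiableWithinAt)
      (fun w hw => by
        rw [fderivWithin_of_isOpen Metric.isOpen_ball hw, (hball w hw).fderiv]) hz
      (Metric.mem_ball_self hr)
  set v := affineNormal b σ ε f y + L • f y with hv
  have hconst' : ∀ᶠ z in nhds y, affineNormal b σ ε f z + L • f z = v :=
    Filter.mem_of_superset (Metric.ball_mem_nhds y hr) hconst
  by_cases hv0 : v = 0
  · filter_upwards [hconst'] with z hz
    rw [hv0] at hz
    rw [neg_smul]
    exact eq_neg_of_add_eq_zero_left hz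
  exfalso
  obtain ⟨r₀, hr₀⟩ := Function.ne_iff.mp hv0
  -- If the constant `v = ξ + L f` were nonzero, then `f = -s ξ` would give `(1 - L s) ξ = v`. So
  -- `ξ` and `f` would both lie on the line of `v`, hence so would `∂f`, contradicting the
  -- independence of `∂f` and `ξ`.
  have hpar : ∀ᶠ z in nhds y, ∃ p : ℝ, p ≠ 0 ∧ p • affineNormal b σ ε f z = v ∧
      ∃ m : ℝ, f z = m • v := by
    filter_upwards [hconst', h] with z h1 h2
    obtain ⟨s, hs⟩ := h2.2
    have hfs : f z = -(s • affineNormal b σ ε f z) := eq_neg_of_add_eq_zero_left hs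
    have hp : (1 - L * s) • affineNormal b σ ε f z = v := by
      rw [← h1, hfs, sub_smul, one_smul, smul_neg, smul_smul, sub_eq_add_neg]
    have hp0 : 1 - L * s ≠ 0 := by
      intro h0
      rw [h0, zero_smul] at hp
      exact hv0 hp.symm
    refine ⟨_, hp0, hp, -(s * (1 - L * s)⁻¹), ?_⟩
    rw [hfs, ← hp, smul_smul, ← neg_smul]
    congr 1
    rw [neg_mul, mul_assoc, inv_mul_cancel₀ hp0, mul_one]
  -- Taking the multiple of `v` from a coordinate in which `v` is nonzero makes it a differentiable
  -- function.
  have hline : ∀ᶠ z in nhds y, f z = (f z r₀ * (v r₀)⁻¹) • v := by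
    filter_upwards [hpar] with z hz
    obtain ⟨p, -, -, m, hm⟩ := hz
    have : f z r₀ = m * v r₀ := by rw [hm]; rfl
    rw [this, mul_assoc, mul_inv_cancel₀ hr₀, mul_one]
    exact hm
  have hpd := (eventually_pd_eq b hline).self_of_nhds i₀
  have hfy := hf.self_of_nhds.differentiableAt (by simp)
  have hcoord : DifferentiableAt ℝ (fun z => f z r₀ * (v r₀)⁻¹) y :=
    ((differentiableAt_pi.mp hfy) r₀).mul_const _
  rw [pd, pd, fderiv_smul_const hcoord] at hpd
  obtain ⟨p, hp, hpv, -⟩ := hpar.self_of_nhds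
  simp only [ContinuousLinearMap.smulRight_apply] at hpd
  set q := fderiv ℝ (fun z => f z r₀ * (v r₀)⁻¹) y (b i₀) with hq
  have := hindep.self_of_nhds 1 (-(q * p)) (by
    rw [pd, hpd, one_smul, ← hpv, smul_smul, ← add_smul]; simp)
  exact one_ne_zero this.1

/-- A hyperbolic affine hypersphere is locally described by centroaffine data. -/
theorem exists_centroaffineSphereAt (hι : 0 < Fintype.card ι)
    (hf : ∀ᶠ z in nhds y, ContDiffAt ℝ ∞ f z)
    (hdet : ∀ᶠ z in nhds y, (Matrix.of fun i j => hForm b σ 1 f i j z).det ≠ 0) {L : ℝ}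
    (hL : L < 0)
    (h : ∀ᶠ z in nhds y, (∀ i, pd b (affineNormal b σ ε f) i z = -(L • pd b f i z)) ∧
      ∃ s : ℝ, f z + s • affineNormal b σ ε f z = 0) :
    ∃ (G : ι → ι → E → ℝ) (Γ : ι → ι → ι → E → ℝ) (C s : ℝ), 0 < C ∧
      ∀ᶠ z in nhds y, CentroaffineSphereAt b σ f G Γ C s z := by
  -- Since `ξ = -L f`, the metric is `G = -L g`. With `P = H^{1/(n+2)}` one has `-L D = ε P` and
  -- `|det g| = P²`, so `|det G| = (-L)ⁿ P² = (-L)ⁿ⁺² D²`, and `ε D` is positive.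
  refine ⟨fun i j z => -L * affineMetric b σ ε f i j z, affineConnection b σ ε f,
    (-L) ^ (Fintype.card ι + 2), ((ε : ℤ) : ℝ), pow_pos (by linarith) _, ?_⟩
  filter_upwards [affineNormal_eq_of_hypersphere hι hf hdet hL h, hf, hdet] with z hξ hfz hdz
  have hL' : 0 < -L := by linarith
  have hsymm := fun i j => pd_pd_comm (b := b) hfz i j
  have hdz' := det_hForm_ne_zero_of_one hdz ε
  have hH : 0 < hDet b σ ε f z := abs_pos.mpr hdz'
  have hD := frameDet_affineNormal hι hdz' hsymm
  have hg := gauss_affine hι hdz' hsymm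
  have hm : (Matrix.of fun i j => -L * affineMetric b σ ε f i j z)
      = (-L) • Matrix.of fun i j => affineMetric b σ ε f i j z := by
    ext i j; simp
  have hgdet : (Matrix.of fun i j => affineMetric b σ ε f i j z).det ≠ 0 := by
    rw [det_affineMetric]
    exact mul_ne_zero (pow_ne_zero _ (Real.rpow_pos_of_pos hH _).ne') hdz'
  have hgs : ∀ i j, affineMetric b σ ε f i j z = affineMetric b σ ε f j i z := by
    intro i j; simp [affineMetric, hForm, hsymm i j]
  have hc : (0 : ℝ) < (Fintype.card ι : ℝ) + 2 := by positivity
  rw [hξ, map_smul, smul_eq_mul, frameDet_apply] at hD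
  set D := (frameMatrix σ (fun l => pd b f l z) (f z)).det with hDdef
  set P := hDet b σ ε f z ^ (1 / ((Fintype.card ι : ℝ) + 2)) with hP
  have hP0 : 0 < P := Real.rpow_pos_of_pos hH _
  refine ⟨fun i j => ?_, ?_, ?_, fun i j => ?_, fun k => ?_⟩
  · rw [hg i j, hξ, smul_smul, mul_comm]
  · have : (-L) * (((ε : ℤ) : ℝ) * D) = P := by
      linear_combination ((ε : ℤ) : ℝ) * hD + P * units_mul_self ε
    exact pos_of_mul_pos_right (this ▸ hP0) hL'.le
  · have hHP : hDet b σ ε f z = P ^ (Fintype.card ι + 2) := by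
      rw [hP, ← Real.rpow_natCast, ← Real.rpow_mul hH.le]
      push_cast
      rw [one_div_mul_cancel hc.ne', Real.rpow_one]
    have hinv : hDet b σ ε f z ^ (-(1 / ((Fintype.card ι : ℝ) + 2))) = P⁻¹ := by
      rw [Real.rpow_neg hH.le]
    rw [hm, Matrix.det_smul, det_affineMetric, hinv, abs_mul, abs_mul, abs_pow, abs_of_pos hL',
      abs_of_pos (pow_pos (inv_pos.mpr hP0) _)]
    change (-L) ^ Fintype.card ι * (P⁻¹ ^ Fintype.card ι * hDet b σ ε f z) = _
    have h1 : ((-L) * D) ^ 2 = P ^ 2 := by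
      rw [hD, mul_pow, pow_two ((ε : ℤ) : ℝ), units_mul_self, one_mul]
    have h2 : P⁻¹ ^ Fintype.card ι * P ^ (Fintype.card ι + 2) = P ^ 2 := by
      rw [pow_add, ← mul_assoc, ← mul_pow, inv_mul_cancel₀ hP0.ne', one_pow, one_mul]
    rw [hHP, h2, ← h1]
    ring
  · rw [hgs i j]
  · have hLC : ∀ k i j, christoffel b (fun i j z => -L * affineMetric b σ ε f i j z) k i j z
        = leviCivita b σ ε f k i j z := fun k i j =>
      christoffel_const_mul (G := affineMetric b σ ε f) hL'.ne' (fun _ _ => rfl) hgdet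
        (fun i j k => pd_const_mul b _ _ _ _) k i j
    have hn : (Fintype.card ι : ℝ) ≠ 0 := by positivity
    have htr := sum_inv_mul_self hgdet (fun i j => hgs i j)
    -- Expanding `ξ` in its own Gauss formula, the trace term already gives `ξ`. The tangential
    -- remainder is zero, and independence of the frame makes each coefficient vanish.
    have hexp := affineNormal_expand (σ := σ) (ε := ε) hg
    have htr' : ∑ i, ∑ j, affineMetricInv b σ ε f i j z * affineMetric b σ ε f i j z
        = Fintype.card ι := htr
    rw [htr', smul_add, smul_smul, one_div_mul_cancel hn, one_smul, right_eq_add,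
      smul_eq_zero_iff_right (one_div_ne_zero hn)] at hexp
    have hDξ : (frameMatrix σ (fun l => pd b f l z) (f z)).det ≠ 0 := by
      intro h0
      rw [hDdef, h0, mul_zero] at hD
      exact mul_ne_zero (by exact_mod_cast ε.ne_zero) hP0.ne' hD.symm
    have hk := (frame_combination_eq_zero σ hDξ (d := 0)
      (by rw [zero_smul, add_zero]; exact hexp)).1 k
    have hinv : (Matrix.of fun i j => -L * affineMetric b σ ε f i j z)⁻¹
        = (-L)⁻¹ • (Matrix.of fun i j => affineMetric b σ ε f i j z)⁻¹ := by
      rw [hm]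
      exact Matrix.inv_smul' (A := Matrix.of fun i j => affineMetric b σ ε f i j z)
        (Units.mk0 (-L) hL'.ne') (isUnit_iff_ne_zero.mpr hgdet)
    simp only [hLC, hinv, Matrix.smul_apply, smul_eq_mul, mul_assoc, ← Finset.mul_sum]
    exact mul_eq_zero_of_right _ hk

/-- The parameter space is a point and the empty determinant is `1`, so with `D` the frame
determinant `C = D⁻²` and `s = D` work. -/
theorem exists_centroaffineSphereAt_of_isEmpty [IsEmpty ι] (hf : f y ≠ 0) :
    ∃ (G : ι → ι → E → ℝ) (Γ : ι → ι → ι → E → ℝ) (C s : ℝ), 0 < C ∧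
      ∀ᶠ z in nhds y, CentroaffineSphereAt b σ f G Γ C s z := by
  have hD : (frameMatrix σ (fun l => pd b f l y) (f y)).det ≠ 0 := by
    intro h0
    obtain ⟨v, hv, hv0⟩ := Matrix.exists_vecMul_eq_zero_iff.mpr h0
    rw [vecMul_frameMatrix] at hv0
    simp only [Finset.univ_eq_empty, Finset.sum_empty, zero_add, smul_eq_zero, hf, or_false] at hv0
    refine hv (funext fun r => ?_)
    rw [← σ.symm_apply_apply r, Subsingleton.elim (σ r) none, hv0]
    rfl
  have : Subsingleton E := b.repr.toEquiv.subsingleton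
  set D := (frameMatrix σ (fun l => pd b f l y) (f y)).det with hDdef
  have hD2 : 0 < D ^ 2 := by positivity
  refine ⟨fun i => isEmptyElim i, fun i => isEmptyElim i, (D ^ 2)⁻¹, D, inv_pos.mpr hD2,
    Filter.Eventually.of_forall fun z => ?_⟩
  obtain rfl := Subsingleton.elim z y
  refine ⟨fun i => isEmptyElim i, ?_, ?_, fun i => isEmptyElim i, fun i => isEmptyElim i⟩
  · rw [← hDdef, ← pow_two]; exact hD2
  · rw [← hDdef, Matrix.det_isEmpty, abs_one, inv_mul_cancel₀ hD2.ne']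

end Hypersphere

/-! ### The exponents of the Calabi composition as an orthogonal system -/

section Slopes

variable {k : ℕ} (n : Fin (k + 1) → ℕ)

/-- The coefficient of `t_l` in `log e_a`. -/
noncomputable def calabiSlope (a : Fin (k + 1)) (l : Fin k) : ℝ :=
  if (l : ℕ) + 1 = a then -(1 / ((n a : ℝ) + 1))
  else if (a : ℕ) ≤ l then 1 / partialDim n l
  else 0

/-- The share of the `a`-th factor in the ambient dimension. -/
noncomputable def calabiWeight (a : Fin (k + 1)) : ℝ :=
  ((n a : ℝ) + 1) / ∑ c, ((n c : ℝ) + 1)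

/-- The squared length of `∂/∂t_l`. -/
noncomputable def calabiNorm (l : Fin k) : ℝ :=
  ∑ a, calabiWeight n a * calabiSlope n a l ^ 2

/-- The coefficients of the `a`-th block of the position vector with respect to `∂/∂t_l`. -/
noncomputable def calabiDual (a : Fin (k + 1)) (l : Fin k) : ℝ :=
  calabiWeight n a * calabiSlope n a l / calabiNorm n l

theorem calabiExp_eq (a : Fin (k + 1)) (t : EuclideanSpace ℝ (Fin k)) :
    calabiExp n a t = Real.exp (∑ l, calabiSlope n a l * t l) := by
  rw [calabiExp]
  congr 1
  refine Finset.sum_congr rfl fun l _ => ?_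
  rw [calabiSlope]
  split_ifs <;> ring

theorem partialDim_pos (l : Fin k) : 0 < partialDim n l :=
  Finset.sum_pos (fun _ _ => by positivity) ⟨l.castSucc, by simp⟩

theorem sum_dim_pos : 0 < ∑ c, ((n c : ℝ) + 1) :=
  Finset.sum_pos (fun _ _ => by positivity) Finset.univ_nonempty

theorem calabiWeight_pos (a : Fin (k + 1)) : 0 < calabiWeight n a :=
  div_pos (by positivity) (sum_dim_pos n)

theorem sum_calabiWeight : ∑ a, calabiWeight n a = 1 := by
  simp only [calabiWeight, ← Finset.sum_div]
  exact div_self (sum_dim_pos n).ne'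

/-- The block with index `l + 1` contributes `-1`; the blocks up to `l` contribute `(n_a + 1)/f_l`,
which add up to `1`. -/
theorem sum_dim_mul_calabiSlope (l : Fin k) :
    ∑ a, ((n a : ℝ) + 1) * calabiSlope n a l = 0 := by
  have h : ∀ a, ((n a : ℝ) + 1) * calabiSlope n a l
      = (if a = l.succ then -1 else 0)
        + (if a ∈ Finset.Iic l.castSucc then (((n a : ℝ) + 1) / partialDim n l) else 0) := by
    intro a
    have h1 : ((l : ℕ) + 1 = a) ↔ a = l.succ := by
      rw [Fin.ext_iff]; simp [eq_comm]
    have h2 : ((a : ℕ) ≤ l) ↔ a ∈ Finset.Iic l.castSucc := by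
      rw [Finset.mem_Iic, Fin.le_def]; simp
    have h0 : (n a : ℝ) + 1 ≠ 0 := by positivity
    rw [calabiSlope]
    simp only [h1, ← h2]
    split_ifs with h3 h4 h4
    · subst h3; simp at h4
    · field_simp; simp
    · ring
    · ring
  rw [Finset.sum_congr rfl fun a _ => h a, Finset.sum_add_distrib, Finset.sum_ite_eq',
    ← Finset.sum_filter, Finset.filter_mem_eq_inter, Finset.univ_inter, ← Finset.sum_div]
  rw [← partialDim, div_self (partialDim_pos n l).ne']
  simp

theorem sum_calabiWeight_mul_slope (l : Fin k) :
    ∑ a, calabiWeight n a * calabiSlope n a l = 0 := by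
  have : ∀ a, calabiWeight n a * calabiSlope n a l
      = (((n a : ℝ) + 1) * calabiSlope n a l) / ∑ c, ((n c : ℝ) + 1) := by
    intro a; rw [calabiWeight]; ring
  simp only [this, ← Finset.sum_div, sum_dim_mul_calabiSlope, zero_div]

/-- For `l < m`, the slope in direction `m` equals `1/f_m` on every block where the slope in
direction `l` is nonzero, so the weighted mean-zero property of the latter finishes. -/
theorem calabiSlope_orthogonal_of_lt {l m : Fin k} (h : l < m) :
    ∑ a, calabiWeight n a * calabiSlope n a l * calabiSlope n a m = 0 := by
  have key : ∀ a, calabiWeight n a * calabiSlope n a l * calabiSlope n a m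
      = calabiWeight n a * calabiSlope n a l * (1 / partialDim n m) := by
    intro a
    by_cases ha : (a : ℕ) ≤ m
    · have : (m : ℕ) + 1 ≠ a := by omega
      congr 1
      rw [calabiSlope, if_neg this, if_pos ha]
    · have hl : calabiSlope n a l = 0 := by
        rw [Fin.lt_def] at h
        rw [calabiSlope, if_neg (by omega), if_neg (by omega)]
      simp [hl]
  rw [Finset.sum_congr rfl fun a _ => key a, ← Finset.sum_mul, sum_calabiWeight_mul_slope,
    zero_mul]

theorem calabiSlope_orthogonal (l m : Fin k) :
    ∑ a, calabiWeight n a * calabiSlope n a l * calabiSlope n a m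
      = if l = m then calabiNorm n l else 0 := by
  split_ifs with h
  · subst h
    exact Finset.sum_congr rfl fun a _ => by ring
  · rcases lt_or_gt_of_ne h with h | h
    · exact calabiSlope_orthogonal_of_lt n h
    · rw [← calabiSlope_orthogonal_of_lt n h]
      exact Finset.sum_congr rfl fun a _ => by ring

theorem calabiNorm_pos (l : Fin k) : 0 < calabiNorm n l := by
  refine Finset.sum_pos' (fun a _ => mul_nonneg (calabiWeight_pos n a).le (sq_nonneg _))
    ⟨l.succ, Finset.mem_univ _, mul_pos (calabiWeight_pos n _) ?_⟩
  rw [calabiSlope, if_pos (by simp), neg_sq]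
  positivity

/-- The expansion of the `a`-th block of the position vector in terms of `∂/∂t` and the position
vector. -/
theorem calabiDual_reproducing (a b : Fin (k + 1)) :
    ∑ p, calabiDual n a p * calabiSlope n b p + calabiWeight n a = if a = b then 1 else 0 := by
  let P : Option (Fin k) → Fin (k + 1) → ℝ := fun o a => o.elim 1 (calabiSlope n a)
  let g : Option (Fin k) → ℝ := fun o => o.elim 1 (calabiNorm n)
  let X : Matrix (Option (Fin k)) (Fin (k + 1)) ℝ := Matrix.of fun o a => (g o)⁻¹ * P o a
  let Y : Matrix (Fin (k + 1)) (Option (Fin k)) ℝ := Matrix.of fun a o => calabiWeight n a * P o a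
  -- Orthogonality of the `K` vectors `1, slope₀, slope₁, …` in `ℝᴷ`. The matrices being square, `Y
  -- * X = 1` follows, and this is the completeness relation sought.
  have hXY : X * Y = 1 := by
    ext o o'
    have : (X * Y) o o' = (g o)⁻¹ * ∑ a, calabiWeight n a * P o a * P o' a := by
      rw [Matrix.mul_apply, Finset.mul_sum]
      exact Finset.sum_congr rfl fun a _ => by simp only [X, Y, Matrix.of_apply]; ring
    rw [this, Matrix.one_apply]
    rcases o with _ | l <;> rcases o' with _ | m
    · simp [P, g, sum_calabiWeight]
    · simp [P, sum_calabiWeight_mul_slope]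
    · simp [P, sum_calabiWeight_mul_slope]
    · simp only [P, g, Option.elim, calabiSlope_orthogonal, Option.some.injEq]
      split_ifs with h
      · exact inv_mul_cancel₀ (calabiNorm_pos n l).ne'
      · simp
  have hYX := (Matrix.mul_eq_one_comm_of_equiv (finSuccEquivLast (n := k)).symm).mp hXY
  have := congrFun (congrFun hYX a) b
  rw [Matrix.mul_apply, Fintype.sum_option, Matrix.one_apply] at this
  rw [← this, add_comm]
  simp only [X, Y, P, g, Matrix.of_apply, Option.elim, inv_one, mul_one]
  congr 1
  exact Finset.sum_congr rfl fun p _ => by rw [calabiDual]; ring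

/-- This relation removes `t` from the frame determinant, hence keeps the volume condition. -/
theorem prod_calabiExp_pow (t : EuclideanSpace ℝ (Fin k)) :
    ∏ a, calabiExp n a t ^ (n a + 1) = 1 := by
  simp only [calabiExp_eq, ← Real.exp_nat_mul, ← Real.exp_sum]
  rw [Real.exp_eq_one_iff]
  simp only [Finset.mul_sum]
  rw [Finset.sum_comm]
  refine Finset.sum_eq_zero fun l _ => ?_
  have := sum_dim_mul_calabiSlope n l
  push_cast
  simp only [← mul_assoc, ← Finset.sum_mul, this, zero_mul]

end Slopes

/-! ### Derivatives on the product parameter space -/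

section Derivatives

/-- The section `s` transfers differentiability back from `g ∘ π` to `g`, so the chain rule holds
for every `g`: in the non-differentiable case both sides are `0`. -/
theorem fderiv_comp_of_rightInverse {E F V : Type*} [NormedAddCommGroup E] [NormedSpace ℝ E]
    [NormedAddCommGroup F] [NormedSpace ℝ F] [NormedAddCommGroup V] [NormedSpace ℝ V]
    (π : E →L[ℝ] F) (s : F →L[ℝ] E) (hs : ∀ u, π (s u) = u) (g : F → V) (q v : E) :
    fderiv ℝ (fun q => g (π q)) q v = fderiv ℝ g (π q) (π v) := by
  by_cases hg : DifferentiableAt ℝ g (π q)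
  · have := (hg.hasFDerivAt.comp q π.hasFDerivAt).fderiv
    have h2 : fderiv ℝ (fun q => g (π q)) q = (fderiv ℝ g (π q)).comp π := this
    rw [h2]
    rfl
  · have hn : ¬ DifferentiableAt ℝ (fun q => g (π q)) q := by
      intro hd
      apply hg
      -- An affine section of `π` chosen to pass through `q` itself, which need not lie in the image
      -- of `s`.
      have h1 : DifferentiableAt ℝ (fun u => q + s (u - π q)) (π q) := by fun_prop
      have h2 : DifferentiableAt ℝ (fun q => g (π q)) (q + s (π q - π q)) := by simpa using hd
      have h3 := DifferentiableAt.comp (π q) h2 h1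
      refine h3.congr_of_eventuallyEq (Filter.Eventually.of_forall fun u => ?_)
      simp [hs]
    rw [fderiv_zero_of_not_differentiableAt hg, fderiv_zero_of_not_differentiableAt hn]
    rfl

variable {k : ℕ} {n : Fin (k + 1) → ℕ}

theorem stdBasis_apply (m : ℕ) (i : Fin m) : stdBasis m i = EuclideanSpace.single i 1 := by
  simp [stdBasis]

theorem calabiBasis_inl (l : Fin k) : calabiBasis n (Sum.inl l) = (stdBasis k l, 0) := by
  simp [calabiBasis]

theorem calabiBasis_inr (i : Σ a, Fin (n a)) :
    calabiBasis n (Sum.inr i) = (0, Pi.single i.1 (stdBasis (n i.1) i.2)) := by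
  obtain ⟨a, i⟩ := i
  simp [calabiBasis, Pi.basis_apply]

theorem fderiv_factor {V : Type*} [NormedAddCommGroup V] [NormedSpace ℝ V] (a : Fin (k + 1))
    (g : EuclideanSpace ℝ (Fin (n a)) → V)
    (q v : EuclideanSpace ℝ (Fin k) × (∀ a, EuclideanSpace ℝ (Fin (n a)))) :
    fderiv ℝ (fun q : EuclideanSpace ℝ (Fin k) × (∀ a, EuclideanSpace ℝ (Fin (n a))) =>
      g (q.2 a)) q v = fderiv ℝ g (q.2 a) (v.2 a) :=
  fderiv_comp_of_rightInverse
    ((ContinuousLinearMap.proj (φ := fun a => EuclideanSpace ℝ (Fin (n a))) a).comp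
      (ContinuousLinearMap.snd ℝ (EuclideanSpace ℝ (Fin k)) _))
    ((ContinuousLinearMap.inr ℝ (EuclideanSpace ℝ (Fin k)) _).comp
      (ContinuousLinearMap.single ℝ (fun a => EuclideanSpace ℝ (Fin (n a))) a))
    (fun u => by simp) g q v

variable {V : Type*} [NormedAddCommGroup V] [NormedSpace ℝ V]
  {q : EuclideanSpace ℝ (Fin k) × (∀ a, EuclideanSpace ℝ (Fin (n a)))}

theorem pd_factor_inl (a : Fin (k + 1)) (g : EuclideanSpace ℝ (Fin (n a)) → V) (l : Fin k) :
    pd (calabiBasis n) (fun q => g (q.2 a)) (Sum.inl l) q = 0 := by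
  rw [pd, fderiv_factor, calabiBasis_inl]
  simp

theorem pd_factor_inr (a : Fin (k + 1)) (g : EuclideanSpace ℝ (Fin (n a)) → V) (i : Fin (n a)) :
    pd (calabiBasis n) (fun q => g (q.2 a)) (Sum.inr ⟨a, i⟩) q
      = pd (stdBasis (n a)) g i (q.2 a) := by
  rw [pd, fderiv_factor, calabiBasis_inr]
  simp [pd]

theorem pd_factor_inr_of_ne {a b : Fin (k + 1)} (h : b ≠ a) (g : EuclideanSpace ℝ (Fin (n a)) → V)
    (i : Fin (n b)) :
    pd (calabiBasis n) (fun q => g (q.2 a)) (Sum.inr ⟨b, i⟩) q = 0 := by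
  rw [pd, fderiv_factor, calabiBasis_inr]
  simp [h.symm]

theorem hasFDerivAt_calabiExp (a : Fin (k + 1)) (t : EuclideanSpace ℝ (Fin k)) :
    HasFDerivAt (calabiExp n a)
      (calabiExp n a t • ∑ l, calabiSlope n a l • (EuclideanSpace.proj l :
        EuclideanSpace ℝ (Fin k) →L[ℝ] ℝ)) t := by
  have h : HasFDerivAt (fun t : EuclideanSpace ℝ (Fin k) => ∑ l, calabiSlope n a l * t l)
      (∑ l, calabiSlope n a l • (EuclideanSpace.proj l : EuclideanSpace ℝ (Fin k) →L[ℝ] ℝ)) t := by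
    convert (∑ l, calabiSlope n a l •
      (EuclideanSpace.proj l : EuclideanSpace ℝ (Fin k) →L[ℝ] ℝ)).hasFDerivAt using 1
    ext t
    simp
  have h2 := h.exp
  rw [← calabiExp_eq] at h2
  refine h2.congr_of_eventuallyEq (Filter.Eventually.of_forall fun t => ?_)
  exact calabiExp_eq n a t

variable {c : Fin (k + 1) → ℝ} {φ : ∀ a, EuclideanSpace ℝ (Fin (n a)) → Fin (n a + 1) → ℝ}

theorem fderiv_calabiComposition (hφ : ∀ a, DifferentiableAt ℝ (φ a) (q.2 a))
    (v : EuclideanSpace ℝ (Fin k) × (∀ a, EuclideanSpace ℝ (Fin (n a))))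
    (r : Σ a, Fin (n a + 1)) :
    fderiv ℝ (calabiComposition n c φ) q v r
      = c r.1 * calabiExp n r.1 q.1 * ((∑ l, calabiSlope n r.1 l * v.1 l) * φ r.1 (q.2 r.1) r.2
        + fderiv ℝ (φ r.1) (q.2 r.1) (v.2 r.1) r.2) := by
  have hr : ∀ r : Σ a, Fin (n a + 1), HasFDerivAt (fun q => calabiComposition n c φ q r)
      ((c r.1 * calabiExp n r.1 q.1) •
        ((ContinuousLinearMap.proj r.2).comp ((fderiv ℝ (φ r.1) (q.2 r.1)).comp
          ((ContinuousLinearMap.proj (φ := fun a => EuclideanSpace ℝ (Fin (n a))) r.1).comp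
            (ContinuousLinearMap.snd ℝ (EuclideanSpace ℝ (Fin k)) _))))
        + φ r.1 (q.2 r.1) r.2 • c r.1 • (calabiExp n r.1 q.1 • ∑ l, calabiSlope n r.1 l •
          (EuclideanSpace.proj l : EuclideanSpace ℝ (Fin k) →L[ℝ] ℝ)).comp
            (ContinuousLinearMap.fst ℝ (EuclideanSpace ℝ (Fin k)) _)) q := by
    intro r
    have h1 := ((hasFDerivAt_calabiExp (n := n) r.1 q.1).comp q
      (ContinuousLinearMap.fst ℝ (EuclideanSpace ℝ (Fin k))
        (∀ a, EuclideanSpace ℝ (Fin (n a)))).hasFDerivAt).const_mul (c r.1)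
    have h2 := (ContinuousLinearMap.proj (R := ℝ) (φ := fun _ : Fin (n r.1 + 1) => ℝ)
      r.2).hasFDerivAt.comp q ((hφ r.1).hasFDerivAt.comp q
        ((ContinuousLinearMap.proj (R := ℝ) (φ := fun a => EuclideanSpace ℝ (Fin (n a))) r.1).comp
            (ContinuousLinearMap.snd ℝ (EuclideanSpace ℝ (Fin k)) _)).hasFDerivAt)
    exact h1.mul h2
  rw [(hasFDerivAt_pi.mpr hr).fderiv]
  simp
  ring

/-- Each first derivative is written again as a `calabiComposition`, with modified factors, so that
the same rules can be iterated to give the second derivatives. -/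
theorem pd_calabi_inl (hφ : ∀ a, DifferentiableAt ℝ (φ a) (q.2 a)) (l : Fin k) :
    pd (calabiBasis n) (calabiComposition n c φ) (Sum.inl l) q
      = calabiComposition n c (fun a u => calabiSlope n a l • φ a u) q := by
  ext r
  rw [pd, fderiv_calabiComposition hφ, calabiBasis_inl, stdBasis_apply]
  simp [calabiComposition]

theorem pd_calabi_inr (hφ : ∀ a, DifferentiableAt ℝ (φ a) (q.2 a)) (i : Σ a, Fin (n a)) :
    pd (calabiBasis n) (calabiComposition n c φ) (Sum.inr i) q
      = calabiComposition n c (Pi.single i.1 fun u => pd (stdBasis (n i.1)) (φ i.1) i.2 u) q := by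
  ext r
  rw [pd, fderiv_calabiComposition hφ, calabiBasis_inr]
  obtain ⟨a, s⟩ := r
  obtain ⟨b, i⟩ := i
  by_cases h : a = b
  · subst h
    simp [calabiComposition, pd]
  · simp [calabiComposition, h]

end Derivatives

/-! ### Block diagonal tensors -/

section SigmaTensor

variable {A : Type*} [DecidableEq A] {ν : A → Type*}

/-- The block diagonal extension of a family of tensors of order two. -/
def sigmaTensor₂ (T : ∀ a, ν a → ν a → ℝ) (i j : Σ a, ν a) : ℝ :=
  if h : j.1 = i.1 then T i.1 i.2 (h ▸ j.2) else 0

/-- The block diagonal extension of a family of tensors of order three. -/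
def sigmaTensor₃ (T : ∀ a, ν a → ν a → ν a → ℝ) (i j l : Σ a, ν a) : ℝ :=
  if h : j.1 = i.1 then if h' : l.1 = i.1 then T i.1 i.2 (h ▸ j.2) (h' ▸ l.2) else 0 else 0

/-- The block diagonal extension of a family of tensors of order four. -/
def sigmaTensor₄ (T : ∀ a, ν a → ν a → ν a → ν a → ℝ) (i j l m : Σ a, ν a) : ℝ :=
  if h : j.1 = i.1 then if h' : l.1 = i.1 then if h'' : m.1 = i.1 then
    T i.1 i.2 (h ▸ j.2) (h' ▸ l.2) (h'' ▸ m.2) else 0 else 0 else 0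

@[simp] theorem sigmaTensor₂_self (T : ∀ a, ν a → ν a → ℝ) (a : A) (i j : ν a) :
    sigmaTensor₂ T ⟨a, i⟩ ⟨a, j⟩ = T a i j := by
  simp [sigmaTensor₂]

theorem sigmaTensor₂_of_ne (T : ∀ a, ν a → ν a → ℝ) {i j : Σ a, ν a} (h : j.1 ≠ i.1) :
    sigmaTensor₂ T i j = 0 := by
  simp [sigmaTensor₂, h]

@[simp] theorem sigmaTensor₃_self (T : ∀ a, ν a → ν a → ν a → ℝ) (a : A) (i j l : ν a) :
    sigmaTensor₃ T ⟨a, i⟩ ⟨a, j⟩ ⟨a, l⟩ = T a i j l := by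
  simp [sigmaTensor₃]

theorem sigmaTensor₃_of_ne (T : ∀ a, ν a → ν a → ν a → ℝ) {i j l : Σ a, ν a}
    (h : ¬ (j.1 = i.1 ∧ l.1 = i.1)) : sigmaTensor₃ T i j l = 0 := by
  simp only [sigmaTensor₃]
  split_ifs with h1 h2
  · exact absurd ⟨h1, h2⟩ h
  · rfl
  · rfl

@[simp] theorem sigmaTensor₄_self (T : ∀ a, ν a → ν a → ν a → ν a → ℝ) (a : A) (i j l m : ν a) :
    sigmaTensor₄ T ⟨a, i⟩ ⟨a, j⟩ ⟨a, l⟩ ⟨a, m⟩ = T a i j l m := by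
  simp [sigmaTensor₄]

theorem sigmaTensor₄_of_ne (T : ∀ a, ν a → ν a → ν a → ν a → ℝ) {i j l m : Σ a, ν a}
    (h : ¬ (j.1 = i.1 ∧ l.1 = i.1 ∧ m.1 = i.1)) : sigmaTensor₄ T i j l m = 0 := by
  simp only [sigmaTensor₄]
  split_ifs with h1 h2 h3
  · exact absurd ⟨h1, h2, h3⟩ h
  · rfl
  · rfl
  · rfl

theorem sum_sigma_eq_block [Fintype A] [∀ a, Fintype (ν a)] {V : Type*} [AddCommMonoid V] (a : A)
    {g : (Σ a, ν a) → V} (h : ∀ p, p.1 ≠ a → g p = 0) : ∑ p, g p = ∑ i, g ⟨a, i⟩ := by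
  rw [Fintype.sum_sigma]
  exact Finset.sum_eq_single a (fun b _ hb => Finset.sum_eq_zero fun i _ => h _ hb) (by simp)

theorem of_sigmaTensor₂ (T : ∀ a, ν a → ν a → ℝ) :
    Matrix.of (sigmaTensor₂ T) = Matrix.blockDiagonal' fun a => Matrix.of (T a) := by
  ext ⟨a, i⟩ ⟨b, j⟩
  by_cases h : b = a
  · subst h
    simp [Matrix.blockDiagonal'_apply_eq]
  · rw [Matrix.blockDiagonal'_apply_ne _ _ _ (Ne.symm h), Matrix.of_apply, sigmaTensor₂_of_ne _ h]

theorem det_blockDiagonal_sigma [LinearOrder A] [Fintype A] [∀ a, Fintype (ν a)]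
    [∀ a, DecidableEq (ν a)] (X : ∀ a, Matrix (ν a) (ν a) ℝ) :
    (Matrix.blockDiagonal' X).det = ∏ a, (X a).det := by
  rw [(Matrix.blockTriangular_blockDiagonal' X).det_fintype]
  refine Finset.prod_congr rfl fun a _ => ?_
  rw [← Matrix.det_submatrix_equiv_self (Equiv.sigmaSubtype (β := ν) a)]
  congr 1
  ext ⟨⟨b, i⟩, hb⟩ ⟨⟨c, j⟩, hc⟩
  obtain rfl : b = a := hb
  obtain rfl : c = b := hc
  simp [Matrix.toSquareBlock, Matrix.toSquareBlockProp, Matrix.blockDiagonal'_apply_eq,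
    Equiv.sigmaSubtype]

end SigmaTensor

/-! ### Metric, connection and Christoffel symbols of the composition -/

section Data

variable {k : ℕ} {n : Fin (k + 1) → ℕ}

/-- The centroaffine metric of the Calabi composition. -/
noncomputable def calabiMetric
    (G : ∀ a, Fin (n a) → Fin (n a) → EuclideanSpace ℝ (Fin (n a)) → ℝ) :
    (Fin k ⊕ Σ a, Fin (n a)) → (Fin k ⊕ Σ a, Fin (n a)) →
    EuclideanSpace ℝ (Fin k) × (∀ a, EuclideanSpace ℝ (Fin (n a))) → ℝ
  | .inl l, .inl m, _ => if l = m then calabiNorm n l else 0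
  | .inr i, .inr j, q => sigmaTensor₂ (fun a i j => calabiWeight n a * G a i j (q.2 a)) i j
  | _, _, _ => 0

/-- The induced connection of the Calabi composition. -/
noncomputable def calabiConnection
    (G : ∀ a, Fin (n a) → Fin (n a) → EuclideanSpace ℝ (Fin (n a)) → ℝ)
    (Γ : ∀ a, Fin (n a) → Fin (n a) → Fin (n a) → EuclideanSpace ℝ (Fin (n a)) → ℝ) :
    (Fin k ⊕ Σ a, Fin (n a)) → (Fin k ⊕ Σ a, Fin (n a)) → (Fin k ⊕ Σ a, Fin (n a)) →
    EuclideanSpace ℝ (Fin k) × (∀ a, EuclideanSpace ℝ (Fin (n a))) → ℝ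
  | .inl p, .inl l, .inl m, _ =>
    ∑ a, calabiSlope n a l * calabiSlope n a m * calabiDual n a p
  | .inl p, .inr i, .inr j, q => sigmaTensor₂ (fun a i j => G a i j (q.2 a) * calabiDual n a p) i j
  | .inr i, .inl l, .inr j, _ => if i = j then calabiSlope n j.1 l else 0
  | .inr i, .inr j, .inl l, _ => if i = j then calabiSlope n j.1 l else 0
  | .inr h, .inr i, .inr j, q => sigmaTensor₃ (fun a h i j => Γ a h i j (q.2 a)) h i j
  | _, _, _, _ => 0

variable {G : ∀ a, Fin (n a) → Fin (n a) → EuclideanSpace ℝ (Fin (n a)) → ℝ}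
  {Γ : ∀ a, Fin (n a) → Fin (n a) → Fin (n a) → EuclideanSpace ℝ (Fin (n a)) → ℝ}
  {q : EuclideanSpace ℝ (Fin k) × (∀ a, EuclideanSpace ℝ (Fin (n a)))}

theorem of_calabiMetric : (Matrix.of fun i j => calabiMetric G i j q)
    = Matrix.fromBlocks (Matrix.diagonal (calabiNorm n)) 0 0
      (Matrix.blockDiagonal' fun a => calabiWeight n a • Matrix.of fun i j => G a i j (q.2 a)) := by
  have h := of_sigmaTensor₂ fun a i j => calabiWeight n a * G a i j (q.2 a)
  ext (l | i) (m | j)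
  · simp [calabiMetric, Matrix.diagonal_apply]
  · simp [calabiMetric]
  · simp [calabiMetric]
  · exact congrFun (congrFun h i) j

theorem det_calabiMetric : (Matrix.of fun i j => calabiMetric G i j q).det
    = (∏ l, calabiNorm n l) * ∏ a, (calabiWeight n a ^ n a
      * (Matrix.of fun i j => G a i j (q.2 a)).det) := by
  rw [of_calabiMetric, Matrix.det_fromBlocks_zero₂₁, Matrix.det_diagonal, det_blockDiagonal_sigma]
  simp only [Matrix.det_smul, Fintype.card_fin]

theorem calabiMetric_inv (h : ∀ a, (Matrix.of fun i j => G a i j (q.2 a)).det ≠ 0) :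
    (Matrix.of fun i j => calabiMetric G i j q)⁻¹
    = Matrix.fromBlocks (Matrix.diagonal fun l => (calabiNorm n l)⁻¹) 0 0
      (Matrix.blockDiagonal' fun a => (calabiWeight n a)⁻¹ •
        (Matrix.of fun i j => G a i j (q.2 a))⁻¹) := by
  rw [of_calabiMetric]
  refine Matrix.inv_eq_right_inv ?_
  have h1 : ∀ a, calabiWeight n a • (Matrix.of fun i j => G a i j (q.2 a)) *
      (calabiWeight n a)⁻¹ • (Matrix.of fun i j => G a i j (q.2 a))⁻¹ = 1 := fun a => by
    rw [Matrix.smul_mul, Matrix.mul_smul, smul_smul, mul_inv_cancel₀ (calabiWeight_pos n a).ne',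
      Matrix.mul_nonsing_inv _ (isUnit_iff_ne_zero.mpr (h a)), one_smul]
  have h2 : ∀ l, calabiNorm n l * (calabiNorm n l)⁻¹ = 1 := fun l =>
    mul_inv_cancel₀ (calabiNorm_pos n l).ne'
  rw [Matrix.fromBlocks_multiply, ← Matrix.blockDiagonal'_mul]
  simp only [h1, Matrix.diagonal_mul_diagonal, h2, Matrix.zero_mul, Matrix.mul_zero, add_zero,
    zero_add]
  have h3 : (Matrix.blockDiagonal' fun a => (1 : Matrix (Fin (n a)) (Fin (n a)) ℝ)) = 1 :=
    Matrix.blockDiagonal'_one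
  rw [h3]
  simp

/-- The derivatives of the metric of the Calabi composition are those of the metrics of its
factors. -/
theorem pd_calabiMetric_inl (i j : Fin k ⊕ Σ a, Fin (n a)) (l : Fin k) :
    pd (calabiBasis n) (fun q => calabiMetric G i j q) (Sum.inl l) q = 0 := by
  rcases i with i | ⟨a, i⟩ <;> rcases j with j | ⟨b, j⟩
  · simp [calabiMetric]
  · simp [calabiMetric]
  · simp [calabiMetric]
  · by_cases h : b = a
    · subst h
      simp only [calabiMetric, sigmaTensor₂_self]
      exact pd_factor_inl b (fun u => calabiWeight n b * G b i j u) l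
    · simp [calabiMetric, sigmaTensor₂_of_ne _ (show (⟨b, j⟩ : Σ a, Fin (n a)).1 ≠
        (⟨a, i⟩ : Σ a, Fin (n a)).1 from h)]

theorem pd_calabiMetric_inr_inl (i : Fin k ⊕ Σ a, Fin (n a)) (l : Fin k)
    (j : Fin k ⊕ Σ a, Fin (n a)) :
    pd (calabiBasis n) (fun q => calabiMetric G i (Sum.inl l) q) j q = 0 := by
  rcases i with i | ⟨a, i⟩ <;> simp [calabiMetric]

theorem pd_calabiMetric_inl_inr (i : Fin k ⊕ Σ a, Fin (n a)) (l : Fin k)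
    (j : Fin k ⊕ Σ a, Fin (n a)) :
    pd (calabiBasis n) (fun q => calabiMetric G (Sum.inl l) i q) j q = 0 := by
  rcases i with i | ⟨a, i⟩ <;> simp [calabiMetric]

theorem pd_sigmaTensor₂ (T : ∀ a, Fin (n a) → Fin (n a) → EuclideanSpace ℝ (Fin (n a)) → ℝ)
    (i j l : Σ a, Fin (n a)) :
    pd (calabiBasis n) (fun q => sigmaTensor₂ (fun a i j => T a i j (q.2 a)) i j) (Sum.inr l) q
      = sigmaTensor₃ (fun a i j l => pd (stdBasis (n a)) (T a i j) l (q.2 a)) i j l := by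
  obtain ⟨a, i⟩ := i; obtain ⟨b, j⟩ := j; obtain ⟨c, l⟩ := l
  by_cases h : b = a
  · subst h
    simp only [sigmaTensor₂_self]
    by_cases h : c = b
    · subst h
      simp only [sigmaTensor₃_self]
      exact pd_factor_inr c (T c i j) l
    · rw [sigmaTensor₃_of_ne _ (by simp [h])]
      exact pd_factor_inr_of_ne h (T b i j) l
  · rw [sigmaTensor₃_of_ne _ (by simp [h])]
    have h' : ∀ q : EuclideanSpace ℝ (Fin k) × (∀ a, EuclideanSpace ℝ (Fin (n a))),
        sigmaTensor₂ (fun a i j => T a i j (q.2 a)) ⟨a, i⟩ ⟨b, j⟩ = 0 := fun q =>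
      sigmaTensor₂_of_ne _ h
    simp [h']

theorem pd_calabiMetric_inr (i j l : Σ a, Fin (n a)) :
    pd (calabiBasis n) (fun q => calabiMetric G (Sum.inr i) (Sum.inr j) q) (Sum.inr l) q
      = sigmaTensor₃ (fun a i j l => calabiWeight n a *
        pd (stdBasis (n a)) (fun u => G a i j u) l (q.2 a)) i j l := by
  simp only [calabiMetric]
  rw [pd_sigmaTensor₂ fun a i j u => calabiWeight n a * G a i j u]
  simp only [pd_const_mul]

/-- The Levi-Civita connection of the metric of the Calabi composition. -/
theorem christoffel_calabiMetric (h : ∀ a, (Matrix.of fun i j => G a i j (q.2 a)).det ≠ 0)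
    (i j l : Σ a, Fin (n a)) :
    christoffel (calabiBasis n) (calabiMetric G) (Sum.inr l) (Sum.inr i) (Sum.inr j) q
      = sigmaTensor₃ (fun a l i j => christoffel (stdBasis (n a)) (G a) l i j (q.2 a)) l i j := by
  rw [christoffel, calabiMetric_inv h, Fintype.sum_sum_type]
  simp only [Matrix.fromBlocks_apply₂₁, Matrix.zero_apply, zero_mul, Finset.sum_const_zero,
    zero_add, Matrix.fromBlocks_apply₂₂, pd_calabiMetric_inr]
  obtain ⟨a, l⟩ := l; obtain ⟨b, i⟩ := i; obtain ⟨c, j⟩ := j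
  rw [sum_sigma_eq_block a fun p hp => by
    rw [show p = ⟨p.1, p.2⟩ from rfl, Matrix.blockDiagonal'_apply_ne _ _ _ (Ne.symm hp), zero_mul]]
  simp only [Matrix.blockDiagonal'_apply_eq]
  by_cases hij : b = a ∧ c = a
  · obtain ⟨rfl, rfl⟩ := hij
    simp only [sigmaTensor₃_self, christoffel, Matrix.smul_apply, smul_eq_mul]
    congr 1
    refine Finset.sum_congr rfl fun p _ => ?_
    have := (calabiWeight_pos n c).ne'
    field_simp
  · rw [sigmaTensor₃_of_ne _ hij]
    refine mul_eq_zero_of_right _ (Finset.sum_eq_zero fun p _ => mul_eq_zero_of_right _ ?_)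
    rw [sigmaTensor₃_of_ne, sigmaTensor₃_of_ne, sigmaTensor₃_of_ne] <;> grind

/-- For a product metric with a constant factor in `t`, a Christoffel symbol with a `t` index in any
position vanishes; this and the next two statements treat the three positions. -/
theorem christoffel_calabiMetric_inl (h : ∀ a, (Matrix.of fun i j => G a i j (q.2 a)).det ≠ 0)
    (i j : Fin k ⊕ Σ a, Fin (n a)) (l : Fin k) :
    christoffel (calabiBasis n) (calabiMetric G) (Sum.inl l) i j q = 0 := by
  rw [christoffel, calabiMetric_inv h, Fintype.sum_sum_type]
  simp only [Matrix.fromBlocks_apply₁₂, Matrix.zero_apply, zero_mul, Finset.sum_const_zero,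
    add_zero, pd_calabiMetric_inl, pd_calabiMetric_inr_inl]
  simp

theorem christoffel_calabiMetric_inl₂ (i j : Fin k ⊕ Σ a, Fin (n a)) (l : Fin k) :
    christoffel (calabiBasis n) (calabiMetric G) i (Sum.inl l) j q = 0 := by
  rw [christoffel]
  simp only [pd_calabiMetric_inl, pd_calabiMetric_inl_inr]
  simp

theorem christoffel_calabiMetric_inl₃ (i j : Fin k ⊕ Σ a, Fin (n a)) (l : Fin k) :
    christoffel (calabiBasis n) (calabiMetric G) i j (Sum.inl l) q = 0 := by
  rw [christoffel]
  simp only [pd_calabiMetric_inl, pd_calabiMetric_inl_inr, pd_calabiMetric_inr_inl]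
  simp

end Data

/-! ### Identities behind the Gauss equation and apolarity -/

section Identities

variable {k : ℕ} (n : Fin (k + 1) → ℕ)

theorem sum_calabiDual (p : Fin k) : ∑ a, calabiDual n a p = 0 := by
  simp only [calabiDual, ← Finset.sum_div, sum_calabiWeight_mul_slope, zero_div]

/-- The expansion of the product of two slope vectors in the orthogonal basis `1, slope`. It is the
`a`-th block of the Gauss equation in the directions `t_l`, `t_m`. -/
theorem calabiSlope_mul_slope (a : Fin (k + 1)) (l m : Fin k) :
    ∑ p, (∑ b, calabiSlope n b l * calabiSlope n b m * calabiDual n b p) * calabiSlope n a p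
      + (if l = m then calabiNorm n l else 0) = calabiSlope n a l * calabiSlope n a m := by
  rw [← calabiSlope_orthogonal]
  simp only [Finset.sum_mul]
  rw [Finset.sum_comm, ← Finset.sum_add_distrib]
  have : ∀ b, ∑ p, calabiSlope n b l * calabiSlope n b m * calabiDual n b p * calabiSlope n a p
      + calabiWeight n b * calabiSlope n b l * calabiSlope n b m
      = calabiSlope n b l * calabiSlope n b m * (if b = a then 1 else 0) := by
    intro b
    rw [← calabiDual_reproducing n b a, mul_add, Finset.mul_sum]
    congr 1
    · exact Finset.sum_congr rfl fun p _ => by ring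
    · ring
  rw [Finset.sum_congr rfl fun b _ => this b]
  simp

/-- By completeness the `a`-th block contributes `w_a⁻¹ (1 - w_a) + w_a⁻¹ n_a = n` times `calabiDual
n a p`, with `n = ∑ (n_c + 1) - 1` independent of `a`; the duals sum to zero over `a`. -/
theorem calabi_apolar (p : Fin k) :
    ∑ l, (calabiNorm n l)⁻¹ * ∑ a, calabiSlope n a l * calabiSlope n a l * calabiDual n a p
      + ∑ a, (calabiWeight n a)⁻¹ * (n a * calabiDual n a p) = 0 := by
  simp only [Finset.mul_sum]
  rw [Finset.sum_comm, ← Finset.sum_add_distrib]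
  have h : ∀ a, ∑ l, (calabiNorm n l)⁻¹ *
        (calabiSlope n a l * calabiSlope n a l * calabiDual n a p)
      + (calabiWeight n a)⁻¹ * (n a * calabiDual n a p)
      = (∑ c, ((n c : ℝ) + 1) - 1) * calabiDual n a p := by
    intro a
    have hw := (calabiWeight_pos n a).ne'
    have h1 : ∀ l, (calabiNorm n l)⁻¹ * (calabiSlope n a l * calabiSlope n a l * calabiDual n a p)
        = (calabiWeight n a)⁻¹ * calabiDual n a p * (calabiDual n a l * calabiSlope n a l) := by
      intro l
      rw [calabiDual, calabiDual]
      field_simp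
    have h2 := calabiDual_reproducing n a a
    rw [if_pos rfl] at h2
    have h3 : ∑ c, ((n c : ℝ) + 1) = (calabiWeight n a)⁻¹ * (n a + 1) := by
      have : (n a : ℝ) + 1 ≠ 0 := by positivity
      have := (sum_dim_pos n).ne'
      rw [calabiWeight]
      field_simp
    rw [Finset.sum_congr rfl fun l _ => h1 l, ← Finset.mul_sum, eq_sub_of_add_eq h2, h3]
    field_simp
    ring
  rw [Finset.sum_congr rfl fun a _ => h a, ← Finset.mul_sum, sum_calabiDual, mul_zero]

theorem sum_blockDiagonal_mul {A : Type*} [Fintype A] [DecidableEq A] {ν : A → Type*}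
    [∀ a, Fintype (ν a)] (X : ∀ a, Matrix (ν a) (ν a) ℝ) (T : (Σ a, ν a) → (Σ a, ν a) → ℝ) :
    ∑ i, ∑ j, Matrix.blockDiagonal' X i j * T i j
      = ∑ a, ∑ i, ∑ j, X a i j * T ⟨a, i⟩ ⟨a, j⟩ := by
  rw [Fintype.sum_sigma]
  refine Finset.sum_congr rfl fun a _ => Finset.sum_congr rfl fun i _ => ?_
  rw [sum_sigma_eq_block a fun p hp => by
    rw [show p = ⟨p.1, p.2⟩ from rfl, Matrix.blockDiagonal'_apply_ne _ _ _ (Ne.symm hp), zero_mul]]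
  simp only [Matrix.blockDiagonal'_apply_eq]

end Identities

/-! ### The Calabi composition of centroaffine spheres -/

section Frame

variable {k : ℕ} {n : Fin (k + 1) → ℕ}

/-- The coefficients of the frame of a Calabi composition in terms of the frames of its factors. -/
noncomputable def calabiFrameCoeff (n : Fin (k + 1) → ℕ) :
    Option (Fin k ⊕ Σ a, Fin (n a)) → ∀ a, Option (Fin (n a)) → ℝ
  | none, _, none => 1
  | some (.inl l), a, none => calabiSlope n a l
  | some (.inr i), a, some j => if i = ⟨a, j⟩ then 1 else 0
  | _, _, _ => 0

/-- Constant in `t` and in the points of the factors. Columns are the frame vectors of the factors,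
the last one in each block being the position vector. -/
noncomputable def calabiFrameMatrix (n : Fin (k + 1) → ℕ)
    (σ : (Σ a, Fin (n a + 1)) ≃ Option (Fin k ⊕ Σ a, Fin (n a))) :
    Matrix (Σ a, Fin (n a + 1)) (Σ a, Fin (n a + 1)) ℝ :=
  Matrix.of fun r r' => calabiFrameCoeff n (σ r) r'.1 (finSuccEquivLast r'.2)

/-- In a kernel vector, the rows of the factor directions annihilate the tangential entries, and
completeness of `1, slope` annihilates the remaining entry of each block. Only nonvanishing matters,
so any ordering `σ` is allowed. -/
theorem det_calabiFrameMatrix_ne_zero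
    (σ : (Σ a, Fin (n a + 1)) ≃ Option (Fin k ⊕ Σ a, Fin (n a))) :
    (calabiFrameMatrix n σ).det ≠ 0 := by
  intro h0
  obtain ⟨v, hv, hv0⟩ := Matrix.exists_mulVec_eq_zero_iff.mpr h0
  have hrow : ∀ o, ∑ a, ∑ s, calabiFrameCoeff n o a s * v ⟨a, finSuccEquivLast.symm s⟩ = 0 := by
    intro o
    have := congrFun hv0 (σ.symm o)
    rw [Matrix.mulVec, dotProduct, Fintype.sum_sigma, Pi.zero_apply] at this
    rw [← this]
    refine Finset.sum_congr rfl fun a _ => ?_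
    rw [← finSuccEquivLast.sum_comp]
    exact Finset.sum_congr rfl fun s _ => by simp [calabiFrameMatrix]
  simp only [Fintype.sum_option] at hrow
  have h1 : ∀ a i, v ⟨a, finSuccEquivLast.symm (some i)⟩ = 0 := by
    intro a i
    have := hrow (some (.inr ⟨a, i⟩))
    simp only [calabiFrameCoeff, zero_mul, zero_add] at this
    rw [Finset.sum_eq_single a _ (by simp), Finset.sum_eq_single i _ (by simp)] at this
    · simpa using this
    · intro j _ hj
      rw [if_neg (by simpa using hj.symm), zero_mul]
    · intro b _ hb
      refine Finset.sum_eq_zero fun j _ => ?_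
      rw [if_neg (fun h => hb (congrArg Sigma.fst h).symm), zero_mul]
  have h2 : ∀ a, v ⟨a, finSuccEquivLast.symm none⟩ = 0 := by
    intro a
    have hn := hrow none
    have hl := fun l => hrow (some (.inl l))
    simp only [calabiFrameCoeff, zero_mul, Finset.sum_const_zero, add_zero, one_mul] at hn hl
    have hsum : ∑ b, (if a = b then 1 else 0) * v ⟨b, finSuccEquivLast.symm none⟩
        = ∑ p, calabiDual n a p * ∑ b, calabiSlope n b p * v ⟨b, finSuccEquivLast.symm none⟩
          + calabiWeight n a * ∑ b, v ⟨b, finSuccEquivLast.symm none⟩ := by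
      simp only [← calabiDual_reproducing n, add_mul, Finset.sum_add_distrib, Finset.mul_sum,
        Finset.sum_mul]
      rw [Finset.sum_comm]
      congr 1
      exact Finset.sum_congr rfl fun p _ => Finset.sum_congr rfl fun b _ => by ring
    simp only [hl, hn, mul_zero, Finset.sum_const_zero, add_zero] at hsum
    simpa using hsum
  refine hv (funext fun r => ?_)
  obtain ⟨a, s⟩ := r
  rw [← finSuccEquivLast.symm_apply_apply s]
  rcases finSuccEquivLast s with _ | i
  · exact h2 a
  · exact h1 a i

variable {c : Fin (k + 1) → ℝ} {f : ∀ a, EuclideanSpace ℝ (Fin (n a)) → Fin (n a + 1) → ℝ}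
  {q : EuclideanSpace ℝ (Fin k) × (∀ a, EuclideanSpace ℝ (Fin (n a)))}

theorem calabi_frameMatrix (σ : (Σ a, Fin (n a + 1)) ≃ Option (Fin k ⊕ Σ a, Fin (n a)))
    (hf : ∀ a, DifferentiableAt ℝ (f a) (q.2 a)) :
    frameMatrix σ (fun l => pd (calabiBasis n) (calabiComposition n c f) l q)
        (calabiComposition n c f q)
      = calabiFrameMatrix n σ * Matrix.blockDiagonal' fun a => (c a * calabiExp n a q.1) •
        frameMatrix finSuccEquivLast (fun l => pd (stdBasis (n a)) (f a) l (q.2 a))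
          (f a (q.2 a)) := by
  ext r ⟨a, t⟩
  obtain ⟨o, rfl⟩ := σ.symm.surjective r
  rw [Matrix.mul_apply, Fintype.sum_sigma, Finset.sum_eq_single a _ (by simp)]
  swap
  · intro b _ hb
    exact Finset.sum_eq_zero fun s _ => by rw [Matrix.blockDiagonal'_apply_ne _ _ _ hb, mul_zero]
  rw [← finSuccEquivLast.symm.sum_comp, Fintype.sum_option]
  simp only [Matrix.blockDiagonal'_apply_eq, calabiFrameMatrix, Matrix.of_apply,
    Equiv.apply_symm_apply, Matrix.smul_apply, frameMatrix_symm_some, frameMatrix_symm_none]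
  rcases o with _ | l | ⟨b, i⟩
  · simp [calabiFrameCoeff, calabiComposition]
  · simp [calabiFrameCoeff, pd_calabi_inl hf, calabiComposition]
    ring
  · simp only [frameMatrix_symm_some, calabiFrameCoeff, pd_calabi_inr hf, calabiComposition]
    by_cases h : b = a
    · subst h
      simp
    · simp [h, Ne.symm h]

/-- The frame is a constant matrix times the block diagonal of the rescaled factor frames, and the
powers of the `e_a` multiply to `1`. -/
theorem det_calabi_frameMatrix (σ : (Σ a, Fin (n a + 1)) ≃ Option (Fin k ⊕ Σ a, Fin (n a)))
    (hf : ∀ a, DifferentiableAt ℝ (f a) (q.2 a)) :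
    (frameMatrix σ (fun l => pd (calabiBasis n) (calabiComposition n c f) l q)
        (calabiComposition n c f q)).det
      = (calabiFrameMatrix n σ).det * (∏ a, c a ^ (n a + 1)) *
        ∏ a, (frameMatrix finSuccEquivLast (fun l => pd (stdBasis (n a)) (f a) l (q.2 a))
          (f a (q.2 a))).det := by
  rw [calabi_frameMatrix σ hf, Matrix.det_mul, det_blockDiagonal_sigma]
  simp only [Matrix.det_smul, Fintype.card_fin, mul_pow, Finset.prod_mul_distrib,
    prod_calabiExp_pow]
  ring

theorem eventually_differentiableAt_factors
    (hf : ∀ a, ContDiffAt ℝ ∞ (f a) (q.2 a)) :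
    ∀ᶠ q' in nhds q, ∀ a, DifferentiableAt ℝ (f a) (q'.2 a) := by
  rw [Filter.eventually_all]
  intro a
  have h1 : ContDiffAt ℝ 1 (f a) (q.2 a) := (hf a).of_le (by norm_cast)
  have h2 : ∀ᶠ u in nhds (q.2 a), DifferentiableAt ℝ (f a) u :=
    (h1.eventually (by simp)).mono fun u hu => hu.differentiableAt (by simp)
  have h3 : Filter.Tendsto (fun q' : EuclideanSpace ℝ (Fin k) ×
      (∀ a, EuclideanSpace ℝ (Fin (n a))) => q'.2 a) (nhds q) (nhds (q.2 a)) := by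
    have : Continuous (fun q' : EuclideanSpace ℝ (Fin k) ×
      (∀ a, EuclideanSpace ℝ (Fin (n a))) => q'.2 a) := by fun_prop
    exact this.tendsto q
  exact h3.eventually h2

/-- Differentiating twice in `t` gives products of slopes (`calabiSlope_mul_slope`); once in `t` and
once in a factor gives a slope times a tangent vector; twice in one factor gives that factor's Gauss
equation, while two different factors give zero. -/
theorem calabi_gauss {G : ∀ a, Fin (n a) → Fin (n a) → EuclideanSpace ℝ (Fin (n a)) → ℝ}
    {Γ : ∀ a, Fin (n a) → Fin (n a) → Fin (n a) → EuclideanSpace ℝ (Fin (n a)) → ℝ}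
    (hf : ∀ a, ContDiffAt ℝ ∞ (f a) (q.2 a))
    (h : ∀ a i j, pd (stdBasis (n a)) (fun y => pd (stdBasis (n a)) (f a) j y) i (q.2 a)
      = ∑ l, Γ a l i j (q.2 a) • pd (stdBasis (n a)) (f a) l (q.2 a)
        + G a i j (q.2 a) • f a (q.2 a)) (i j : Fin k ⊕ Σ a, Fin (n a)) :
    pd (calabiBasis n) (fun y => pd (calabiBasis n) (calabiComposition n c f) j y) i q
      = ∑ l, calabiConnection G Γ l i j q • pd (calabiBasis n) (calabiComposition n c f) l q
        + calabiMetric G i j q • calabiComposition n c f q := by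
  have hev := eventually_differentiableAt_factors hf
  have hd := hev.self_of_nhds
  have hpd : ∀ a j, DifferentiableAt ℝ (fun u => pd (stdBasis (n a)) (f a) j u) (q.2 a) :=
    fun a j => (((hf a).fderiv_right (m := 1) (by norm_cast)).differentiableAt
      one_ne_zero).clm_apply (differentiableAt_const _)
  have hsingle : ∀ (j : Σ a, Fin (n a)) a, DifferentiableAt ℝ
      ((Pi.single j.1 (fun u => pd (stdBasis (n j.1)) (f j.1) j.2 u) :
        ∀ a, EuclideanSpace ℝ (Fin (n a)) → Fin (n a + 1) → ℝ) a) (q.2 a) := by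
    rintro ⟨b, j⟩ a
    by_cases hab : a = b
    · subst hab
      simpa using hpd a j
    · simp only [Pi.single_eq_of_ne hab]
      exact differentiableAt_const _
  have hl : ∀ l : Fin k, (fun y => pd (calabiBasis n) (calabiComposition n c f) (Sum.inl l) y)
      =ᶠ[nhds q] calabiComposition n c fun a u => calabiSlope n a l • f a u :=
    fun l => hev.mono fun q' hq' => pd_calabi_inl hq' l
  have hr : ∀ j : Σ a, Fin (n a),
      (fun y => pd (calabiBasis n) (calabiComposition n c f) (Sum.inr j) y)
      =ᶠ[nhds q] calabiComposition n c
        (Pi.single j.1 fun u => pd (stdBasis (n j.1)) (f j.1) j.2 u) :=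
    fun j => hev.mono fun q' hq' => pd_calabi_inr hq' j
  rw [Fintype.sum_sum_type]
  simp only [pd_calabi_inl hd, pd_calabi_inr hd]
  rcases i with l | ⟨a, i⟩ <;> rcases j with m | ⟨b, j⟩
  · rw [pd_congr _ (hl m), pd_calabi_inl fun a => (hd a).fun_const_smul _]
    ext ⟨a, t⟩
    simp only [calabiComposition, calabiConnection, calabiMetric, Pi.smul_apply, Pi.add_apply,
      Finset.sum_apply, smul_eq_mul, zero_mul, Finset.sum_const_zero, add_zero]
    rw [← mul_assoc (calabiSlope n a l), ← calabiSlope_mul_slope, add_mul, mul_add, Finset.sum_mul,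
      Finset.mul_sum]
    congr 1
    · exact Finset.sum_congr rfl fun p _ => by ring
    · ring
  · rw [pd_congr _ (hr ⟨b, j⟩), pd_calabi_inl (hsingle ⟨b, j⟩)]
    simp only [calabiConnection, calabiMetric, zero_smul, Finset.sum_const_zero, add_zero,
      zero_add, ite_smul, Finset.sum_ite_eq', Finset.mem_univ, if_true]
    ext ⟨a, t⟩
    by_cases hab : a = b
    · subst hab
      simp [calabiComposition]
      ring
    · simp [calabiComposition, hab]
  · rw [pd_congr _ (hl m), pd_calabi_inr fun a => (hd a).fun_const_smul _]
    simp only [calabiConnection, calabiMetric, zero_smul, Finset.sum_const_zero, add_zero,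
      zero_add, ite_smul, Finset.sum_ite_eq', Finset.mem_univ, if_true]
    ext ⟨b, t⟩
    by_cases hab : b = a
    · subst hab
      simp only [calabiComposition, Pi.single_eq_same, Pi.smul_apply, smul_eq_mul]
      rw [pd, pd, fderiv_fun_const_smul (hd b)]
      simp
      ring
    · simp [calabiComposition, hab]
  · rw [pd_congr _ (hr ⟨b, j⟩), pd_calabi_inr (hsingle ⟨b, j⟩)]
    by_cases hab : b = a
    · subst hab
      simp only [calabiConnection, calabiMetric, sigmaTensor₂_self, Pi.single_eq_same]
      rw [sum_sigma_eq_block b fun p hp => by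
        rw [sigmaTensor₃_of_ne _ (by simp [Ne.symm hp]), zero_smul]]
      simp only [sigmaTensor₃_self]
      ext ⟨a, t⟩
      simp only [calabiComposition, Pi.smul_apply, Pi.add_apply, Finset.sum_apply, smul_eq_mul]
      have hrep := calabiDual_reproducing n b a
      -- The Gauss equation of factor `b` has a term along block `b` of the position vector alone;
      -- completeness redistributes it over the vectors `∂/∂t_p` and the whole position vector.
      have e1 : ∑ p, G b i j (q.2 b) * calabiDual n b p *
          (c a * calabiExp n a q.1 * (calabiSlope n a p * f a (q.2 a) t))
          + calabiWeight n b * G b i j (q.2 b) * (c a * calabiExp n a q.1 * f a (q.2 a) t)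
          = (if b = a then 1 else 0) *
            (G b i j (q.2 b) * (c a * calabiExp n a q.1 * f a (q.2 a) t)) := by
        rw [← hrep, add_mul, Finset.sum_mul]
        congr 1
        · exact Finset.sum_congr rfl fun p _ => by ring
        · ring
      by_cases hab : a = b
      · subst hab
        simp only [if_true, one_mul] at e1
        rw [add_right_comm, e1]
        have e2 := congrFun (h a i j) t
        simp only [Pi.add_apply, Finset.sum_apply, Pi.smul_apply, smul_eq_mul] at e2
        simp only [Pi.single_eq_same, e2, mul_add, Finset.mul_sum]
        refine (add_comm _ _).trans (congrArg₂ (· + ·) ?_ ?_)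
        · ring
        · exact Finset.sum_congr rfl fun p _ => by ring
      · rw [if_neg (Ne.symm hab), zero_mul] at e1
        rw [add_right_comm, e1]
        simp [hab]
    · have h0 : ∀ u, pd (stdBasis (n a))
          ((Pi.single b (fun u => pd (stdBasis (n b)) (f b) j u) :
            ∀ a, EuclideanSpace ℝ (Fin (n a)) → Fin (n a + 1) → ℝ) a) i u = 0 := by
        intro u
        rw [Pi.single_eq_of_ne (Ne.symm hab)]
        exact pd_const _ _ _ _
      simp only [calabiConnection, calabiMetric, h0]
      have h1 : ∀ p, sigmaTensor₃ (fun a h i j => Γ a h i j (q.2 a)) p ⟨a, i⟩ ⟨b, j⟩ = 0 :=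
        fun p => sigmaTensor₃_of_ne _ (by rintro ⟨h1, h2⟩; exact hab (h2.trans h1.symm))
      simp only [h1, zero_smul, Finset.sum_const_zero, add_zero,
        sigmaTensor₂_of_ne _ (show (⟨b, j⟩ : Σ a, Fin (n a)).1 ≠
          (⟨a, i⟩ : Σ a, Fin (n a)).1 from hab)]
      ext ⟨b, t⟩
      have h2 : (Pi.single a fun _ => 0 :
          ∀ a, EuclideanSpace ℝ (Fin (n a)) → Fin (n a + 1) → ℝ) = 0 :=
        Pi.single_zero a
      simp [calabiComposition, h2]

/-- The Calabi composition of centroaffine spheres is one. -/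
theorem calabi_centroaffineSphereAt
    {G : ∀ a, Fin (n a) → Fin (n a) → EuclideanSpace ℝ (Fin (n a)) → ℝ}
    {Γ : ∀ a, Fin (n a) → Fin (n a) → Fin (n a) → EuclideanSpace ℝ (Fin (n a)) → ℝ}
    {C s : Fin (k + 1) → ℝ} (σ : (Σ a, Fin (n a + 1)) ≃ Option (Fin k ⊕ Σ a, Fin (n a)))
    (hc : ∀ a, 0 < c a) (hC : ∀ a, 0 < C a)
    (hf : ∀ a, ContDiffAt ℝ ∞ (f a) (q.2 a))
    (h : ∀ a, CentroaffineSphereAt (stdBasis (n a)) finSuccEquivLast (f a) (G a) (Γ a) (C a) (s a)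
      (q.2 a)) :
    CentroaffineSphereAt (calabiBasis n) σ (calabiComposition n c f) (calabiMetric G)
      (calabiConnection G Γ)
      ((∏ l, calabiNorm n l) * (∏ a, calabiWeight n a ^ n a) * (∏ a, C a) /
        ((calabiFrameMatrix n σ).det * ∏ a, c a ^ (n a + 1)) ^ 2)
      ((calabiFrameMatrix n σ).det * (∏ a, c a ^ (n a + 1)) * ∏ a, s a) q := by
  have hd := (eventually_differentiableAt_factors hf).self_of_nhds
  have hG := fun a => (h a).det_metric_ne_zero (hC a)
  have hP : (calabiFrameMatrix n σ).det * ∏ a, c a ^ (n a + 1) ≠ 0 :=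
    mul_ne_zero (det_calabiFrameMatrix_ne_zero σ)
      (Finset.prod_pos fun a _ => pow_pos (hc a) _).ne'
  refine ⟨calabi_gauss hf fun a i j => (h a).gauss i j, ?_, ?_, ?_, ?_⟩
  · rw [det_calabi_frameMatrix σ hd, mul_mul_mul_comm, ← Finset.prod_mul_distrib]
    exact mul_pos (mul_self_pos.mpr hP) (Finset.prod_pos fun a _ => (h a).pos)
  · have h1 : |∏ l, calabiNorm n l| = ∏ l, calabiNorm n l :=
      abs_of_pos (Finset.prod_pos fun l _ => calabiNorm_pos n l)
    have h2 : ∀ a, |calabiWeight n a ^ n a * (Matrix.of fun i j => G a i j (q.2 a)).det|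
        = calabiWeight n a ^ n a * C a * (frameMatrix finSuccEquivLast
          (fun l => pd (stdBasis (n a)) (f a) l (q.2 a)) (f a (q.2 a))).det ^ 2 := fun a => by
      rw [abs_mul, (h a).vol, abs_of_pos (pow_pos (calabiWeight_pos n a) _), mul_assoc]
    rw [det_calabi_frameMatrix σ hd, det_calabiMetric, abs_mul, h1, Finset.abs_prod,
      Finset.prod_congr rfl fun a _ => h2 a, Finset.prod_mul_distrib, Finset.prod_mul_distrib,
      Finset.prod_pow, mul_pow _ (∏ a, (frameMatrix _ _ _).det), ← mul_assoc (_ / _),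
      div_mul_cancel₀ _ (pow_ne_zero 2 hP)]
    ring
  · rintro (l | ⟨a, i⟩) (m | ⟨b, j⟩)
    · simp only [calabiMetric]
      by_cases hlm : l = m
      · subst hlm; rfl
      · rw [if_neg hlm, if_neg (Ne.symm hlm)]
    · rfl
    · rfl
    · simp only [calabiMetric]
      by_cases hab : b = a
      · subst hab
        simp [(h b).symm i j]
      · rw [sigmaTensor₂_of_ne _ hab, sigmaTensor₂_of_ne _ (Ne.symm hab)]
  · intro p
    rw [calabiMetric_inv hG]
    simp only [Fintype.sum_sum_type, Matrix.fromBlocks_apply₁₁, Matrix.fromBlocks_apply₁₂,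
      Matrix.fromBlocks_apply₂₁, Matrix.fromBlocks_apply₂₂, Matrix.zero_apply, zero_mul,
      Finset.sum_const_zero, add_zero, zero_add, sum_blockDiagonal_mul, Matrix.diagonal_apply,
      ite_mul, Finset.sum_ite_eq, Finset.mem_univ, if_true, Matrix.smul_apply, smul_eq_mul,
      christoffel_calabiMetric_inl₂, sub_zero]
    rcases p with p | ⟨b, p⟩
    -- For an upper index in `t`, each factor contributes the trace of its own metric, namely `n_a`.
    · rw [← calabi_apolar n p]
      simp only [christoffel_calabiMetric_inl hG, calabiConnection, sigmaTensor₂_self, sub_zero]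
      congr 1
      refine Finset.sum_congr rfl fun a _ => ?_
      have := sum_inv_mul_self (hG a) (fun i j => (h a).symm i j)
      simp only [Matrix.of_apply] at this
      rw [Fintype.card_fin] at this
      rw [← this]
      simp only [Finset.mul_sum, Finset.sum_mul]
      exact Finset.sum_congr rfl fun i _ => Finset.sum_congr rfl fun j _ => by ring
    · simp only [christoffel_calabiMetric hG, calabiConnection, mul_zero, Finset.sum_const_zero,
        zero_add]
      rw [Finset.sum_eq_single b _ (by simp)]
      · simp only [sigmaTensor₃_self, mul_assoc, ← Finset.mul_sum, (h b).apolar, mul_zero]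
      · intro a _ hab
        refine Finset.sum_eq_zero fun i _ => Finset.sum_eq_zero fun j _ => ?_
        rw [sigmaTensor₃_of_ne _ (by simp [hab]), sigmaTensor₃_of_ne _ (by simp [hab])]
        simp

end Frame

/-! ### Metric compatibility of the Levi-Civita connection -/

section Compatibility

variable {E : Type*} [NormedAddCommGroup E] [NormedSpace ℝ E] {ι : Type*} [Fintype ι]
  [DecidableEq ι] {b : Module.Basis ι ℝ E} {G : ι → ι → E → ℝ} {z : E}

/-- Lowering the upper index cancels the inverse metric and leaves the Koszul formula. -/
theorem sum_christoffel_mul (hdet : (Matrix.of fun i j => G i j z).det ≠ 0)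
    (hs : ∀ᶠ y in nhds z, ∀ i j, G i j y = G j i y) (l i j : ι) :
    ∑ m, christoffel b G m l i z * G m j z
      = (1 / 2) * (pd b (fun y => G i j y) l z + pd b (fun y => G l j y) i z
        - pd b (fun y => G l i y) j z) := by
  have h : ∀ p, ∑ m, G m j z * (Matrix.of fun i j => G i j z)⁻¹ m p = if j = p then 1 else 0 := by
    intro p
    have := congrFun (congrFun (Matrix.mul_nonsing_inv _ (isUnit_iff_ne_zero.mpr hdet)) j) p
    rw [Matrix.mul_apply, Matrix.one_apply] at this
    rw [← this]
    exact Finset.sum_congr rfl fun m _ => by rw [hs.self_of_nhds m j]; rfl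
  simp only [christoffel, Finset.mul_sum, Finset.sum_mul]
  rw [Finset.sum_comm]
  have h2 : ∀ p, ∑ m, 1 / 2 * ((Matrix.of fun i j => G i j z)⁻¹ m p *
      (pd b (fun z => G i p z) l z + pd b (fun z => G l p z) i z - pd b (fun z => G l i z) p z)) *
      G m j z = (if j = p then 1 else 0) * (1 / 2 *
      (pd b (fun z => G i p z) l z + pd b (fun z => G l p z) i z - pd b (fun z => G l i z) p z)) := by
    intro p
    rw [← h p, Finset.sum_mul]
    exact Finset.sum_congr rfl fun m _ => by ring
  rw [Finset.sum_congr rfl fun p _ => h2 p]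
  simp

/-- The Levi-Civita connection is metric. -/
theorem metric_compatible (hdet : (Matrix.of fun i j => G i j z).det ≠ 0)
    (hs : ∀ᶠ y in nhds z, ∀ i j, G i j y = G j i y) (i j l : ι) :
    pd b (fun y => G i j y) l z - ∑ m, christoffel b G m l i z * G m j z
      - ∑ m, christoffel b G m l j z * G i m z = 0 := by
  have hp : ∀ i j l, pd b (fun y => G i j y) l z = pd b (fun y => G j i y) l z :=
    fun i j l => pd_congr b (hs.mono fun y hy => hy i j) l
  have h1 : ∑ m, christoffel b G m l j z * G i m z = ∑ m, christoffel b G m l j z * G m i z :=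
    Finset.sum_congr rfl fun m _ => by rw [hs.self_of_nhds i m]
  rw [h1, sum_christoffel_mul hdet hs, sum_christoffel_mul hdet hs, hp j i l]
  ring

end Compatibility

/-! ### The cubic form of the composition and its covariant derivative -/

section Calabi

variable {k : ℕ} {n : Fin (k + 1) → ℕ}
  {G : ∀ a, Fin (n a) → Fin (n a) → EuclideanSpace ℝ (Fin (n a)) → ℝ}
  {Γ : ∀ a, Fin (n a) → Fin (n a) → Fin (n a) → EuclideanSpace ℝ (Fin (n a)) → ℝ}
  {q : EuclideanSpace ℝ (Fin k) × (∀ a, EuclideanSpace ℝ (Fin (n a)))}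

theorem pd_sigmaTensor₂_inl (T : ∀ a, Fin (n a) → Fin (n a) → EuclideanSpace ℝ (Fin (n a)) → ℝ)
    (i j : Σ a, Fin (n a)) (l : Fin k) :
    pd (calabiBasis n) (fun q => sigmaTensor₂ (fun a i j => T a i j (q.2 a)) i j) (Sum.inl l) q
      = 0 := by
  obtain ⟨a, i⟩ := i; obtain ⟨b, j⟩ := j
  by_cases h : b = a
  · subst h
    simp only [sigmaTensor₂_self]
    exact pd_factor_inl b (T b i j) l
  · have h' : ∀ q : EuclideanSpace ℝ (Fin k) × (∀ a, EuclideanSpace ℝ (Fin (n a))),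
        sigmaTensor₂ (fun a i j => T a i j (q.2 a)) ⟨a, i⟩ ⟨b, j⟩ = 0 := fun q =>
      sigmaTensor₂_of_ne _ h
    simp [h']

theorem pd_sigmaTensor₃_inl
    (T : ∀ a, Fin (n a) → Fin (n a) → Fin (n a) → EuclideanSpace ℝ (Fin (n a)) → ℝ)
    (i j m : Σ a, Fin (n a)) (l : Fin k) :
    pd (calabiBasis n) (fun q => sigmaTensor₃ (fun a i j m => T a i j m (q.2 a)) i j m)
      (Sum.inl l) q = 0 := by
  obtain ⟨a, i⟩ := i; obtain ⟨b, j⟩ := j; obtain ⟨c, m⟩ := m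
  by_cases h : b = a ∧ c = a
  · obtain ⟨rfl, rfl⟩ := h
    simp only [sigmaTensor₃_self]
    exact pd_factor_inl c (T c i j m) l
  · have h' : ∀ q : EuclideanSpace ℝ (Fin k) × (∀ a, EuclideanSpace ℝ (Fin (n a))),
        sigmaTensor₃ (fun a i j m => T a i j m (q.2 a)) ⟨a, i⟩ ⟨b, j⟩ ⟨c, m⟩ = 0 := fun q =>
      sigmaTensor₃_of_ne _ h
    simp [h']

theorem pd_sigmaTensor₃
    (T : ∀ a, Fin (n a) → Fin (n a) → Fin (n a) → EuclideanSpace ℝ (Fin (n a)) → ℝ)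
    (i j m l : Σ a, Fin (n a)) :
    pd (calabiBasis n) (fun q => sigmaTensor₃ (fun a i j m => T a i j m (q.2 a)) i j m)
      (Sum.inr l) q
      = sigmaTensor₄ (fun a i j m l => pd (stdBasis (n a)) (T a i j m) l (q.2 a)) i j m l := by
  obtain ⟨a, i⟩ := i; obtain ⟨b, j⟩ := j; obtain ⟨c, m⟩ := m; obtain ⟨d, l⟩ := l
  by_cases h : b = a ∧ c = a
  · obtain ⟨rfl, rfl⟩ := h
    simp only [sigmaTensor₃_self]
    by_cases h : d = c
    · subst h
      simp only [sigmaTensor₄_self]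
      exact pd_factor_inr d (T d i j m) l
    · rw [sigmaTensor₄_of_ne _ (by simp [h])]
      exact pd_factor_inr_of_ne h (T c i j m) l
  · rw [sigmaTensor₄_of_ne _ (by grind)]
    have h' : ∀ q : EuclideanSpace ℝ (Fin k) × (∀ a, EuclideanSpace ℝ (Fin (n a))),
        sigmaTensor₃ (fun a i j m => T a i j m (q.2 a)) ⟨a, i⟩ ⟨b, j⟩ ⟨c, m⟩ = 0 := fun q =>
      sigmaTensor₃_of_ne _ h
    simp [h']

/-- The components of the cubic form of a Calabi composition with one index among the `t_m`. -/
noncomputable def calabiMixed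
    (G : ∀ a, Fin (n a) → Fin (n a) → EuclideanSpace ℝ (Fin (n a)) → ℝ) (m : Fin k)
    (i j : Σ a, Fin (n a)) (q : EuclideanSpace ℝ (Fin k) × (∀ a, EuclideanSpace ℝ (Fin (n a)))) :
    ℝ :=
  sigmaTensor₂ (fun a i j => -2 * calabiSlope n a m * calabiWeight n a * G a i j (q.2 a)) i j

/-- Only constancy is recorded, by comparison with the value at the origin; the value itself plays
no role. -/
theorem cubicForm_calabi_ttt (l m p : Fin k) :
    cubicForm (calabiBasis n) (calabiMetric G) (calabiConnection G Γ) (.inl l) (.inl m) (.inl p) q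
      = cubicForm (calabiBasis n) (calabiMetric G) (calabiConnection G Γ)
        (.inl l) (.inl m) (.inl p) 0 := by
  simp only [cubicForm, Fintype.sum_sum_type, calabiMetric, calabiConnection, pd_const]

theorem cubicForm_calabi_ttu (l m : Fin k) (i : Σ a, Fin (n a)) :
    cubicForm (calabiBasis n) (calabiMetric G) (calabiConnection G Γ) (.inl l) (.inl m) (.inr i) q
      = 0 := by
  simp [cubicForm, Fintype.sum_sum_type, calabiMetric, calabiConnection]

theorem cubicForm_calabi_tut (l m : Fin k) (i : Σ a, Fin (n a)) :
    cubicForm (calabiBasis n) (calabiMetric G) (calabiConnection G Γ) (.inl l) (.inr i) (.inl m) q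
      = 0 := by
  simp [cubicForm, Fintype.sum_sum_type, calabiMetric, calabiConnection]

theorem cubicForm_calabi_utt (l m : Fin k) (i : Σ a, Fin (n a)) :
    cubicForm (calabiBasis n) (calabiMetric G) (calabiConnection G Γ) (.inr i) (.inl l) (.inl m) q
      = 0 := by
  simp [cubicForm, Fintype.sum_sum_type, calabiMetric, calabiConnection]

theorem cubicForm_calabi_uut (m : Fin k) (i j : Σ a, Fin (n a)) :
    cubicForm (calabiBasis n) (calabiMetric G) (calabiConnection G Γ) (.inr i) (.inr j) (.inl m) q
      = calabiMixed G m i j q := by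
  rw [cubicForm, pd_calabiMetric_inl]
  simp only [Fintype.sum_sum_type, calabiMetric, calabiConnection,
    calabiMixed, mul_zero, zero_mul, Finset.sum_const_zero, zero_add, ite_mul,
    Finset.sum_ite_eq', Finset.mem_univ, if_true]
  obtain ⟨a, i⟩ := i; obtain ⟨b, j⟩ := j
  by_cases h : b = a
  · subst h
    simp only [sigmaTensor₂_self]
    ring
  · simp [sigmaTensor₂_of_ne _ (show (⟨b, j⟩ : Σ a, Fin (n a)).1 ≠
      (⟨a, i⟩ : Σ a, Fin (n a)).1 from h)]

theorem calabiDual_mul_norm (a : Fin (k + 1)) (m : Fin k) :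
    calabiDual n a m * calabiNorm n m = calabiWeight n a * calabiSlope n a m :=
  div_mul_cancel₀ _ (calabiNorm_pos n m).ne'

/-- Here the two connection terms are different: one comes from the `t` component of `∂ᵢ∂ⱼx`, the
other from the slope. They agree because `calabiDual` times `calabiNorm` is weight times slope, as
total symmetry of the cubic form demands. -/
theorem cubicForm_calabi_utu (hs : ∀ a i j, G a i j (q.2 a) = G a j i (q.2 a)) (m : Fin k)
    (i j : Σ a, Fin (n a)) :
    cubicForm (calabiBasis n) (calabiMetric G) (calabiConnection G Γ) (.inr i) (.inl m) (.inr j) q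
      = calabiMixed G m i j q := by
  rw [cubicForm, pd_calabiMetric_inr_inl]
  simp only [Fintype.sum_sum_type, calabiMetric,
    calabiConnection, calabiMixed, mul_zero, zero_mul, Finset.sum_const_zero, zero_add, add_zero,
    ite_mul, mul_ite, Finset.sum_ite_eq', Finset.mem_univ, if_true]
  obtain ⟨a, i⟩ := i; obtain ⟨b, j⟩ := j
  by_cases h : b = a
  · subst h
    simp only [sigmaTensor₂_self, mul_assoc, calabiDual_mul_norm, hs b j i]
    ring
  · simp [sigmaTensor₂_of_ne _ (show (⟨b, j⟩ : Σ a, Fin (n a)).1 ≠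
      (⟨a, i⟩ : Σ a, Fin (n a)).1 from h), sigmaTensor₂_of_ne _ (show (⟨a, i⟩ : Σ a, Fin (n a)).1 ≠
      (⟨b, j⟩ : Σ a, Fin (n a)).1 from Ne.symm h)]

theorem cubicForm_calabi_tuu (hs : ∀ a i j, G a i j (q.2 a) = G a j i (q.2 a)) (m : Fin k)
    (i j : Σ a, Fin (n a)) :
    cubicForm (calabiBasis n) (calabiMetric G) (calabiConnection G Γ) (.inl m) (.inr i) (.inr j) q
      = calabiMixed G m i j q := by
  rw [cubicForm, pd_calabiMetric_inl_inr]
  simp only [Fintype.sum_sum_type, calabiMetric,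
    calabiConnection, calabiMixed, mul_zero, zero_mul, Finset.sum_const_zero, zero_add, add_zero,
    ite_mul, mul_ite, Finset.sum_ite_eq, Finset.sum_ite_eq', Finset.mem_univ, if_true]
  obtain ⟨a, i⟩ := i; obtain ⟨b, j⟩ := j
  by_cases h : b = a
  · subst h
    simp only [sigmaTensor₂_self, mul_assoc, calabiDual_mul_norm, hs b j i]
    ring
  · simp [sigmaTensor₂_of_ne _ (show (⟨b, j⟩ : Σ a, Fin (n a)).1 ≠
      (⟨a, i⟩ : Σ a, Fin (n a)).1 from h), sigmaTensor₂_of_ne _ (show (⟨a, i⟩ : Σ a, Fin (n a)).1 ≠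
      (⟨b, j⟩ : Σ a, Fin (n a)).1 from Ne.symm h)]

theorem cubicForm_calabi_uuu (i j l : Σ a, Fin (n a)) :
    cubicForm (calabiBasis n) (calabiMetric G) (calabiConnection G Γ) (.inr i) (.inr j) (.inr l) q
      = sigmaTensor₃ (fun a i j l => calabiWeight n a *
        cubicForm (stdBasis (n a)) (G a) (Γ a) i j l (q.2 a)) i j l := by
  rw [cubicForm, pd_calabiMetric_inr]
  simp only [Fintype.sum_sum_type, calabiMetric, calabiConnection, mul_zero,
    Finset.sum_const_zero, zero_add]
  obtain ⟨a, i⟩ := i; obtain ⟨b, j⟩ := j; obtain ⟨c, l⟩ := l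
  by_cases h : b = a ∧ c = a
  · obtain ⟨rfl, rfl⟩ := h
    rw [sum_sigma_eq_block c fun p hp => by
        rw [sigmaTensor₂_of_ne _ (Ne.symm hp), mul_zero],
      sum_sigma_eq_block c fun p hp => by rw [sigmaTensor₂_of_ne _ hp, mul_zero]]
    simp only [sigmaTensor₂_self, sigmaTensor₃_self, cubicForm, mul_sub, Finset.mul_sum]
    congr 1
    · congr 1
      exact Finset.sum_congr rfl fun p _ => by ring
    · exact Finset.sum_congr rfl fun p _ => by ring
  · rw [sigmaTensor₃_of_ne _ h, sigmaTensor₃_of_ne _ h, Finset.sum_eq_zero, Finset.sum_eq_zero]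
    · simp
    · rintro ⟨d, p⟩ -
      by_cases h1 : d = a
      · rw [sigmaTensor₃_of_ne _ (by grind), zero_mul]
      · rw [sigmaTensor₂_of_ne _ h1, mul_zero]
    · rintro ⟨d, p⟩ -
      by_cases h1 : b = d
      · rw [sigmaTensor₃_of_ne _ (by grind), zero_mul]
      · rw [sigmaTensor₂_of_ne _ h1, mul_zero]

/-- The mixed components of the cubic form are parallel. -/
theorem calabiMixed_parallel (hG : ∀ a, (Matrix.of fun i j => G a i j (q.2 a)).det ≠ 0)
    (hs : ∀ a, ∀ᶠ u in nhds (q.2 a), ∀ i j, G a i j u = G a j i u) (m : Fin k)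
    (i j l : Σ a, Fin (n a)) :
    pd (calabiBasis n) (fun q => calabiMixed G m i j q) (.inr l) q
      - ∑ p, christoffel (calabiBasis n) (calabiMetric G) (.inr p) (.inr l) (.inr i) q *
        calabiMixed G m p j q
      - ∑ p, christoffel (calabiBasis n) (calabiMetric G) (.inr p) (.inr l) (.inr j) q *
        calabiMixed G m i p q = 0 := by
  simp only [calabiMixed, christoffel_calabiMetric hG]
  rw [pd_sigmaTensor₂ fun a i j u => -2 * calabiSlope n a m * calabiWeight n a * G a i j u]
  simp only [pd_const_mul]
  obtain ⟨a, i⟩ := i; obtain ⟨b, j⟩ := j; obtain ⟨c, l⟩ := l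
  by_cases h : b = a ∧ c = a
  · obtain ⟨rfl, rfl⟩ := h
    rw [sum_sigma_eq_block c fun p hp => by
        rw [sigmaTensor₂_of_ne _ (Ne.symm hp), mul_zero],
      sum_sigma_eq_block c fun p hp => by rw [sigmaTensor₂_of_ne _ hp, mul_zero]]
    simp only [sigmaTensor₂_self, sigmaTensor₃_self]
    have := congrArg (fun x => -2 * calabiSlope n c m * calabiWeight n c * x)
      (metric_compatible (b := stdBasis (n c)) (hG c) (hs c) i j l)
    simp only [mul_sub, Finset.mul_sum, mul_zero] at this
    rw [← this]
    congr 1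
    · congr 1
      exact Finset.sum_congr rfl fun p _ => by ring
    · exact Finset.sum_congr rfl fun p _ => by ring
  · rw [sigmaTensor₃_of_ne _ h, Finset.sum_eq_zero, Finset.sum_eq_zero]
    · simp
    · rintro ⟨d, p⟩ -
      by_cases h1 : d = a
      · rw [sigmaTensor₃_of_ne _ (by grind), zero_mul]
      · rw [sigmaTensor₂_of_ne _ h1, mul_zero]
    · rintro ⟨d, p⟩ -
      by_cases h1 : b = d
      · rw [sigmaTensor₃_of_ne _ (by grind), zero_mul]
      · rw [sigmaTensor₂_of_ne _ h1, mul_zero]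

/-- The sums run over factor indices only, since Christoffel symbols with upper index in `t` vanish,
and block diagonality confines them to one factor. -/
theorem covDeriv_calabi_uuuu (hG : ∀ a, (Matrix.of fun i j => G a i j (q.2 a)).det ≠ 0)
    (i j m l : Σ a, Fin (n a)) :
    covDeriv (calabiBasis n) (calabiMetric G)
      (cubicForm (calabiBasis n) (calabiMetric G) (calabiConnection G Γ))
      (.inr i) (.inr j) (.inr m) (.inr l) q
      = sigmaTensor₄ (fun a i j m l => calabiWeight n a * covDeriv (stdBasis (n a)) (G a)
        (cubicForm (stdBasis (n a)) (G a) (Γ a)) i j m l (q.2 a)) i j m l := by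
  simp only [covDeriv, Fintype.sum_sum_type, christoffel_calabiMetric_inl hG, zero_mul,
    Finset.sum_const_zero, zero_add, christoffel_calabiMetric hG, cubicForm_calabi_uuu]
  rw [pd_sigmaTensor₃ fun a i j l u => calabiWeight n a *
    cubicForm (stdBasis (n a)) (G a) (Γ a) i j l u]
  simp only [pd_const_mul]
  obtain ⟨a, i⟩ := i; obtain ⟨b, j⟩ := j; obtain ⟨c, m⟩ := m; obtain ⟨d, l⟩ := l
  by_cases h : b = a ∧ c = a ∧ d = a
  · obtain ⟨rfl, rfl, rfl⟩ := h
    rw [sum_sigma_eq_block d fun p hp => by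
        rw [sigmaTensor₃_of_ne _ (by simp [Ne.symm hp]), zero_mul],
      sum_sigma_eq_block d fun p hp => by
        rw [sigmaTensor₃_of_ne _ (by simp [Ne.symm hp]), zero_mul],
      sum_sigma_eq_block d fun p hp => by
        rw [sigmaTensor₃_of_ne _ (by simp [Ne.symm hp]), zero_mul]]
    simp only [sigmaTensor₃_self, sigmaTensor₄_self, mul_sub, Finset.mul_sum]
    congr 1
    · congr 1
      · congr 1
        exact Finset.sum_congr rfl fun p _ => by ring
      · exact Finset.sum_congr rfl fun p _ => by ring
    · exact Finset.sum_congr rfl fun p _ => by ring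
  · rw [sigmaTensor₄_of_ne _ h, sigmaTensor₄_of_ne _ h, Finset.sum_eq_zero, Finset.sum_eq_zero,
      Finset.sum_eq_zero]
    · simp
    all_goals
      rintro ⟨e, p⟩ -
      simp only [mul_eq_zero]
      by_contra! h0
      have h1 := fun h => h0.1 (sigmaTensor₃_of_ne _ h)
      have h2 := fun h => h0.2 (sigmaTensor₃_of_ne _ h)
      grind

/-- Nothing depends on `t` and the `t` directions are flat, so the only components needing an
argument have one `t` among the first three indices and are differentiated along a factor. There the
cubic form is a multiple of the factor metrics, which are parallel. -/
theorem covDeriv_calabi_eq_zero_of_inl (hG : ∀ a, (Matrix.of fun i j => G a i j (q.2 a)).det ≠ 0)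
    (hs : ∀ a, ∀ᶠ u in nhds (q.2 a), ∀ i j, G a i j u = G a j i u)
    (i j m l : Fin k ⊕ Σ a, Fin (n a))
    (h : ¬ ∃ i' j' m' l', i = .inr i' ∧ j = .inr j' ∧ m = .inr m' ∧ l = .inr l') :
    covDeriv (calabiBasis n) (calabiMetric G)
      (cubicForm (calabiBasis n) (calabiMetric G) (calabiConnection G Γ)) i j m l q = 0 := by
  have hs' : ∀ᶠ q' in nhds q, ∀ a i j, G a i j (q'.2 a) = G a j i (q'.2 a) := by
    rw [Filter.eventually_all]
    intro a
    have hcont : Continuous (fun q' : EuclideanSpace ℝ (Fin k) ×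
      (∀ a, EuclideanSpace ℝ (Fin (n a))) => q'.2 a) := by fun_prop
    exact (hcont.tendsto q).eventually (hs a)
  have hutu : ∀ m i j, (fun q => cubicForm (calabiBasis n) (calabiMetric G) (calabiConnection G Γ)
      (.inr i) (.inl m) (.inr j) q) =ᶠ[nhds q] fun q => calabiMixed G m i j q :=
    fun m i j => hs'.mono fun q' hq' => cubicForm_calabi_utu hq' m i j
  have htuu : ∀ m i j, (fun q => cubicForm (calabiBasis n) (calabiMetric G) (calabiConnection G Γ)
      (.inl m) (.inr i) (.inr j) q) =ᶠ[nhds q] fun q => calabiMixed G m i j q :=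
    fun m i j => hs'.mono fun q' hq' => cubicForm_calabi_tuu hq' m i j
  have hs0 := hs'.self_of_nhds
  have hmixed : ∀ m i j (l : Fin k),
      pd (calabiBasis n) (fun q => calabiMixed G m i j q) (.inl l) q = 0 := fun m i j l =>
    pd_sigmaTensor₂_inl
      (fun a i j u => -2 * calabiSlope n a m * calabiWeight n a * G a i j u) i j l
  have huuu : ∀ i j m (l : Fin k), pd (calabiBasis n) (fun q => cubicForm (calabiBasis n)
      (calabiMetric G) (calabiConnection G Γ) (.inr i) (.inr j) (.inr m) q) (.inl l) q = 0 := by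
    intro i j m l
    simp only [cubicForm_calabi_uuu]
    exact pd_sigmaTensor₃_inl (fun a i j l u => calabiWeight n a *
      cubicForm (stdBasis (n a)) (G a) (Γ a) i j l u) i j m l
  have httt : ∀ i j m l, pd (calabiBasis n) (fun q => cubicForm (calabiBasis n)
      (calabiMetric G) (calabiConnection G Γ) (.inl i) (.inl j) (.inl m) q) l q = 0 := by
    intro i j m l
    simp only [cubicForm_calabi_ttt i j m]
    exact pd_const _ _ _ _
  rw [covDeriv]
  -- Simplification settles all but four of the sixteen index patterns: three positions of a single
  -- `t`, and the pattern without `t`, which is excluded by `h`.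
  rcases i with i | i <;> rcases j with j | j <;> rcases m with m | m <;> rcases l with l | l <;>
    simp only [Fintype.sum_sum_type, christoffel_calabiMetric_inl₂, christoffel_calabiMetric_inl₃,
      christoffel_calabiMetric_inl hG, zero_mul, Finset.sum_const_zero, zero_add, sub_zero,
      cubicForm_calabi_ttu, cubicForm_calabi_tut, cubicForm_calabi_utt, mul_zero, pd_const,
      cubicForm_calabi_uut, cubicForm_calabi_utu hs0, cubicForm_calabi_tuu hs0, httt, huuu,
      pd_congr _ (hutu _ _ _), pd_congr _ (htuu _ _ _), hmixed]
  · exact calabiMixed_parallel hG hs i j m l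
  · exact calabiMixed_parallel hG hs j i m l
  · exact calabiMixed_parallel hG hs m i j l
  · exact absurd ⟨i, j, m, l, rfl, rfl, rfl, rfl⟩ h

/-- The cubic form of a Calabi composition is parallel if and only if those of the factors are. -/
theorem covDeriv_calabi_eq_zero_iff (hG : ∀ a, (Matrix.of fun i j => G a i j (q.2 a)).det ≠ 0)
    (hs : ∀ a, ∀ᶠ u in nhds (q.2 a), ∀ i j, G a i j u = G a j i u) :
    (∀ i j m l, covDeriv (calabiBasis n) (calabiMetric G)
      (cubicForm (calabiBasis n) (calabiMetric G) (calabiConnection G Γ)) i j m l q = 0) ↔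
    ∀ a i j m l, covDeriv (stdBasis (n a)) (G a)
      (cubicForm (stdBasis (n a)) (G a) (Γ a)) i j m l (q.2 a) = 0 := by
  constructor
  · intro h a i j m l
    have := h (.inr ⟨a, i⟩) (.inr ⟨a, j⟩) (.inr ⟨a, m⟩) (.inr ⟨a, l⟩)
    rw [covDeriv_calabi_uuuu hG, sigmaTensor₄_self] at this
    exact (mul_eq_zero.mp this).resolve_left (calabiWeight_pos n a).ne'
  · intro h i j m l
    by_cases hu : ∃ i' j' m' l', i = .inr i' ∧ j = .inr j' ∧ m = .inr m' ∧ l = .inr l'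
    · obtain ⟨⟨a, i⟩, ⟨b, j⟩, ⟨c, m⟩, ⟨d, l⟩, rfl, rfl, rfl, rfl⟩ := hu
      rw [covDeriv_calabi_uuuu hG]
      simp only [h, mul_zero]
      simp [sigmaTensor₄]
    · exact covDeriv_calabi_eq_zero_of_inl hG hs i j m l hu

end Calabi

/-! ### The local equivalence -/

section Local

variable {E : Type*} [NormedAddCommGroup E] [NormedSpace ℝ E]
  {ι κ : Type*} [Fintype ι] [DecidableEq ι] [Fintype κ] [DecidableEq κ]
  {b : Module.Basis ι ℝ E} {σ : κ ≃ Option ι} {f : E → κ → ℝ}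
  {G : ι → ι → E → ℝ} {Γ : ι → ι → ι → E → ℝ} {C s : ℝ} {y : E}

theorem fubiniPickDeriv_eq_zero_iff (hC : 0 < C)
    (h : ∀ᶠ z in nhds y, CentroaffineSphereAt b σ f G Γ C s z) :
    (∀ (ε : ℤˣ) (i j k l : ι), fubiniPickDeriv b σ ε f i j k l y = 0) ↔
      ∀ i j k l, covDeriv b G (cubicForm b G Γ) i j k l y = 0 := by
  constructor
  · intro h0 i j k l
    obtain ⟨θ, hθ, hθ'⟩ := fubiniPickDeriv_eq hC h 1
    exact (mul_eq_zero.mp ((hθ' i j k l).symm.trans (h0 1 i j k l))).resolve_left hθ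
  · intro h0 ε i j k l
    obtain ⟨θ, hθ, hθ'⟩ := fubiniPickDeriv_eq hC h ε
    rw [hθ', h0, mul_zero]

end Local

section LocalCalabi

variable {k : ℕ} {n : Fin (k + 1) → ℕ} {c : Fin (k + 1) → ℝ}
  {f : ∀ a, EuclideanSpace ℝ (Fin (n a)) → Fin (n a + 1) → ℝ}
  {q : EuclideanSpace ℝ (Fin k) × (∀ a, EuclideanSpace ℝ (Fin (n a)))}

theorem contDiffAt_calabiComposition (hf : ∀ a, ContDiffAt ℝ ∞ (f a) (q.2 a)) :
    ContDiffAt ℝ ∞ (calabiComposition n c f) q := by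
  rw [contDiffAt_pi]
  rintro ⟨a, t⟩
  have h1 : ContDiffAt ℝ ∞ (fun q : EuclideanSpace ℝ (Fin k) ×
      (∀ a, EuclideanSpace ℝ (Fin (n a))) => calabiExp n a q.1) q := by
    simp only [calabiExp_eq]
    fun_prop
  have h2 : ContDiffAt ℝ ∞ (fun q : EuclideanSpace ℝ (Fin k) ×
      (∀ a, EuclideanSpace ℝ (Fin (n a))) => f a (q.2 a)) q :=
    ContDiffAt.comp (f := fun q : EuclideanSpace ℝ (Fin k) ×
      (∀ a, EuclideanSpace ℝ (Fin (n a))) => q.2 a) q (hf a)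
      ((ContinuousLinearMap.proj (R := ℝ) (φ := fun a => EuclideanSpace ℝ (Fin (n a))) a).comp
        (ContinuousLinearMap.snd ℝ (EuclideanSpace ℝ (Fin k)) _)).contDiff.contDiffAt
  exact (contDiffAt_const.mul h1).mul (contDiffAt_pi.mp h2 t)

/-- The theorem at a single point of a parameter domain, along with the nondegeneracy of the
composition, which follows from the factors being hyperspheres and not from parallelism. -/
theorem calabi_local (σ : (Σ a, Fin (n a + 1)) ≃ Option (Fin k ⊕ Σ a, Fin (n a)))
    (hc : ∀ a, 0 < c a) (hf : ∀ a, ∀ᶠ u in nhds (q.2 a), ContDiffAt ℝ ∞ (f a) u)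
    (h : ∀ a, ∃ (G : Fin (n a) → Fin (n a) → EuclideanSpace ℝ (Fin (n a)) → ℝ)
      (Γ : Fin (n a) → Fin (n a) → Fin (n a) → EuclideanSpace ℝ (Fin (n a)) → ℝ) (C s : ℝ),
      0 < C ∧ ∀ᶠ u in nhds (q.2 a),
        CentroaffineSphereAt (stdBasis (n a)) finSuccEquivLast (f a) G Γ C s u) :
    (Matrix.of fun i j => hForm (calabiBasis n) σ 1 (calabiComposition n c f) i j q).det ≠ 0 ∧
    ((∀ (ε : ℤˣ) i j m l,
        fubiniPickDeriv (calabiBasis n) σ ε (calabiComposition n c f) i j m l q = 0) ↔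
      ∀ a, ∀ (ε : ℤˣ) i j m l,
        fubiniPickDeriv (stdBasis (n a)) finSuccEquivLast ε (f a) i j m l (q.2 a) = 0) := by
  choose G Γ C s hC hev using h
  have hproj : ∀ a, Filter.Tendsto (fun q' : EuclideanSpace ℝ (Fin k) ×
      (∀ a, EuclideanSpace ℝ (Fin (n a))) => q'.2 a) (nhds q) (nhds (q.2 a)) := fun a =>
    Continuous.tendsto (by fun_prop) q
  have hF := (Filter.eventually_all.mpr fun a => (hproj a).eventually (hev a)).and
    (Filter.eventually_all.mpr fun a => (hproj a).eventually (hf a))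
  have hF' := hF.mono fun q' hq' => calabi_centroaffineSphereAt σ hc hC hq'.2 hq'.1
  have hpos : 0 < (∏ l, calabiNorm n l) * (∏ a, calabiWeight n a ^ n a) * (∏ a, C a) /
      ((calabiFrameMatrix n σ).det * ∏ a, c a ^ (n a + 1)) ^ 2 := by
    have h1 : (calabiFrameMatrix n σ).det * ∏ a, c a ^ (n a + 1) ≠ 0 :=
      mul_ne_zero (det_calabiFrameMatrix_ne_zero σ)
        (Finset.prod_pos fun a _ => pow_pos (hc a) _).ne'
    have h2 : 0 < ∏ l, calabiNorm n l := Finset.prod_pos fun l _ => calabiNorm_pos n l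
    have h3 : 0 < ∏ a, calabiWeight n a ^ n a :=
      Finset.prod_pos fun a _ => pow_pos (calabiWeight_pos n a) _
    have h4 : 0 < ∏ a, C a := Finset.prod_pos fun a _ => hC a
    exact div_pos (mul_pos (mul_pos h2 h3) h4) (by positivity)
  refine ⟨hF'.self_of_nhds.det_hForm_ne_zero hpos 1, ?_⟩
  rw [fubiniPickDeriv_eq_zero_iff hpos hF', covDeriv_calabi_eq_zero_iff
    (fun a => (hev a).self_of_nhds.det_metric_ne_zero (hC a))
    (fun a => (hev a).mono fun u hu => hu.symm)]
  exact forall_congr' fun a => (fubiniPickDeriv_eq_zero_iff (hC a) (hev a)).symm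

end LocalCalabi

/-! ### Charts of the product manifold -/

section Manifold

theorem contDiffAt_chart {m : ℕ} {κ : Type*} [Fintype κ] {M : Type*} [TopologicalSpace M]
    [ChartedSpace (EuclideanSpace ℝ (Fin m)) M] [IsManifold (𝓡 m) ∞ M] {x : M → κ → ℝ}
    (hx : ContMDiff (𝓡 m) 𝓘(ℝ, κ → ℝ) ∞ x)
    {e : OpenPartialHomeomorph M (EuclideanSpace ℝ (Fin m))}
    (he : e ∈ atlas (EuclideanSpace ℝ (Fin m)) M) {y : EuclideanSpace ℝ (Fin m)}
    (hy : y ∈ (e.extend (𝓡 m)).target) :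
    ContDiffAt ℝ ∞ (x ∘ (e.extend (𝓡 m)).symm) y := by
  have h1 := contMDiffOn_extend_symm (I := 𝓡 m) (n := ∞) (IsManifold.subset_maximalAtlas he)
  rw [← OpenPartialHomeomorph.extend_target'] at h1
  have h2 := (hx.comp_contMDiffOn h1).contDiffOn
  exact h2.contDiffAt (e.isOpen_extend_target.mem_nhds hy)

theorem IsHyperbolicAffineHypersphere.exists_centroaffineSphereAt {m : ℕ} {M : Type*}
    [TopologicalSpace M] [ChartedSpace (EuclideanSpace ℝ (Fin m)) M] [IsManifold (𝓡 m) ∞ M]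
    {x : M → Fin (m + 1) → ℝ}
    (hx : IsHyperbolicAffineHypersphere (𝓡 m) (stdBasis m) finSuccEquivLast x)
    {e : OpenPartialHomeomorph M (EuclideanSpace ℝ (Fin m))}
    (he : e ∈ atlas (EuclideanSpace ℝ (Fin m)) M) {y : EuclideanSpace ℝ (Fin m)}
    (hy : y ∈ (e.extend (𝓡 m)).target) :
    ∃ (G : Fin m → Fin m → EuclideanSpace ℝ (Fin m) → ℝ)
      (Γ : Fin m → Fin m → Fin m → EuclideanSpace ℝ (Fin m) → ℝ) (C s : ℝ), 0 < C ∧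
      ∀ᶠ z in nhds y, CentroaffineSphereAt (stdBasis m) finSuccEquivLast
        (x ∘ (e.extend (𝓡 m)).symm) G Γ C s z := by
  obtain ⟨⟨hsmooth, hdet⟩, hpos, hzero⟩ := hx
  rcases Nat.eq_zero_or_pos m with rfl | hm
  · exact exists_centroaffineSphereAt_of_isEmpty (hzero (by simp) _)
  · have hcard : 0 < Fintype.card (Fin m) := by simpa using hm
    obtain ⟨L, hL, h⟩ := hpos hcard
    obtain ⟨ε, hε⟩ := h e he y hy
    have hopen := e.isOpen_extend_target (I := 𝓡 m) |>.mem_nhds hy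
    exact EquiAffine.exists_centroaffineSphereAt hcard
      (Filter.mem_of_superset hopen fun z hz => contDiffAt_chart hsmooth he hz)
      (Filter.mem_of_superset hopen fun z hz => hdet e he z hz) hL hε

variable {k : ℕ} {n : Fin (k + 1) → ℕ} {M : Fin (k + 1) → Type*} [∀ a, TopologicalSpace (M a)]
  [∀ a, ChartedSpace (EuclideanSpace ℝ (Fin (n a))) (M a)] [∀ a, IsManifold (𝓡 (n a)) ∞ (M a)]
  {x : ∀ a, M a → Fin (n a + 1) → ℝ} {c : Fin (k + 1) → ℝ}

/-- The product chart of `ℝ^{K-1} × ∏ M_a`. -/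
noncomputable def calabiChart
    (e : ∀ a, OpenPartialHomeomorph (M a) (EuclideanSpace ℝ (Fin (n a)))) :
    OpenPartialHomeomorph (EuclideanSpace ℝ (Fin k) × (∀ a, M a))
      (ModelProd (EuclideanSpace ℝ (Fin k)) (ModelPi fun a => EuclideanSpace ℝ (Fin (n a)))) :=
  (OpenPartialHomeomorph.refl _).prod (OpenPartialHomeomorph.pi e)

/-- The model space has only the identity chart in its atlas, so every chart of the product is a
product of charts. No invariance under a change of coordinates is therefore needed. -/
theorem mem_atlas_calabi_iff
    {E : OpenPartialHomeomorph (EuclideanSpace ℝ (Fin k) × (∀ a, M a))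
      (ModelProd (EuclideanSpace ℝ (Fin k)) (ModelPi fun a => EuclideanSpace ℝ (Fin (n a))))} :
    E ∈ atlas (ModelProd (EuclideanSpace ℝ (Fin k))
        (ModelPi fun a => EuclideanSpace ℝ (Fin (n a))))
      (EuclideanSpace ℝ (Fin k) × (∀ a, M a)) ↔
    ∃ e : ∀ a, OpenPartialHomeomorph (M a) (EuclideanSpace ℝ (Fin (n a))),
      (∀ a, e a ∈ atlas (EuclideanSpace ℝ (Fin (n a))) (M a)) ∧ E = calabiChart e := by
  constructor
  · rintro ⟨e₁, he₁, _, ⟨e, he, rfl⟩, rfl⟩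
    obtain rfl := chartedSpaceSelf_atlas.mp he₁
    exact ⟨e, fun a => he a (Set.mem_univ a), rfl⟩
  · rintro ⟨e, he, rfl⟩
    exact ⟨_, chartedSpaceSelf_atlas.mpr rfl, _, ⟨e, fun a _ => he a, rfl⟩, rfl⟩

theorem mem_calabiChart_target
    {e : ∀ a, OpenPartialHomeomorph (M a) (EuclideanSpace ℝ (Fin (n a)))}
    {y : EuclideanSpace ℝ (Fin k) × (∀ a, EuclideanSpace ℝ (Fin (n a)))} :
    y ∈ ((calabiChart e).extend (calabiModel n)).target ↔
      ∀ a, y.2 a ∈ ((e a).extend (𝓡 (n a))).target := by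
  have h1 : ∀ a, ((e a).extend (𝓡 (n a))).target = (e a).target := fun a => by simp
  have h2 : ((calabiChart e).extend (calabiModel n)).target
      = {y | ∀ a, y.2 a ∈ (e a).target} := by
    rw [OpenPartialHomeomorph.extend_target']
    ext y
    constructor
    · rintro ⟨z, hz, rfl⟩ a
      exact hz.2 a (Set.mem_univ a)
    · intro hy
      exact ⟨y, ⟨Set.mem_univ _, fun a _ => hy a⟩, rfl⟩
  rw [h2]
  simp only [h1, Set.mem_ofPred_eq]

theorem calabi_comp_chart (e : ∀ a, OpenPartialHomeomorph (M a) (EuclideanSpace ℝ (Fin (n a)))) :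
    calabiComposition n c x ∘ ((calabiChart e).extend (calabiModel n)).symm
      = calabiComposition n c fun a => x a ∘ ((e a).extend (𝓡 (n a))).symm :=
  rfl

theorem contMDiff_calabiComposition
    (hx : ∀ a, ContMDiff (𝓡 (n a)) 𝓘(ℝ, Fin (n a + 1) → ℝ) ∞ (x a)) :
    ContMDiff (calabiModel n) 𝓘(ℝ, (Σ a, Fin (n a + 1)) → ℝ) ∞ (calabiComposition n c x) := by
  intro q
  rw [contMDiffAt_iff]
  constructor
  · refine continuousAt_pi.mpr fun r => Continuous.continuousAt ?_
    have h1 : Continuous (calabiExp n r.1) := by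
      rw [show calabiExp n r.1 = _ from funext (calabiExp_eq n r.1)]
      fun_prop
    have h2 := (hx r.1).continuous
    unfold calabiComposition
    fun_prop
  · refine ContDiffAt.contDiffWithinAt ?_
    change ContDiffAt ℝ ∞ (calabiComposition n c x ∘
      ((calabiChart fun a => chartAt _ (q.2 a)).extend (calabiModel n)).symm) _
    rw [calabi_comp_chart]
    exact contDiffAt_calabiComposition fun a =>
      contDiffAt_chart (hx a) (chart_mem_atlas _ _) (mem_extChartAt_target (q.2 a))

end Manifold

end EquiAffine

/-! ### The global theorem -/

theorem mainTheorem6 (k : ℕ) (hk : 1 ≤ k) (n : Fin (k + 1) → ℕ)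
    (M : Fin (k + 1) → Type*) [∀ a, TopologicalSpace (M a)]
    [∀ a, ChartedSpace (EuclideanSpace ℝ (Fin (n a))) (M a)]
    [∀ a, IsManifold (𝓡 (n a)) ∞ (M a)] [∀ a, Nonempty (M a)]
    (x : ∀ a, M a → Fin (n a + 1) → ℝ)
    (hx : ∀ a, EquiAffine.IsHyperbolicAffineHypersphere (𝓡 (n a)) (EquiAffine.stdBasis (n a))
      finSuccEquivLast (x a))
    (c : Fin (k + 1) → ℝ) (hc : ∀ a, 0 < c a) :
    EquiAffine.HasParallelFubiniPick (EquiAffine.calabiModel n) (EquiAffine.calabiBasis n)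
        (EquiAffine.calabiOrder n) (EquiAffine.calabiComposition n c x) ↔
      ∀ a, EquiAffine.HasParallelFubiniPick (𝓡 (n a)) (EquiAffine.stdBasis (n a))
        finSuccEquivLast (x a) := by
  have hlocal := fun (e : ∀ a, OpenPartialHomeomorph (M a) (EuclideanSpace ℝ (Fin (n a))))
      (he : ∀ a, e a ∈ atlas (EuclideanSpace ℝ (Fin (n a))) (M a))
      (y : EuclideanSpace ℝ (Fin k) × (∀ a, EuclideanSpace ℝ (Fin (n a))))
      (hy : ∀ a, y.2 a ∈ ((e a).extend (𝓡 (n a))).target) =>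
    EquiAffine.calabi_local (q := y) (EquiAffine.calabiOrder n) hc
      (fun a => Filter.mem_of_superset ((e a).isOpen_extend_target.mem_nhds (hy a))
        fun z hz => EquiAffine.contDiffAt_chart (hx a).1.1 (he a) hz)
      (fun a => (hx a).exists_centroaffineSphereAt (he a) (hy a))
  constructor
  · rintro ⟨-, hF⟩ a
    refine ⟨(hx a).1, fun e he y hy => ?_⟩
    -- To test one factor in a given chart, complete the chart and the point to a product chart and
    -- a point of its target, using arbitrary points of the other factors; nonemptiness enters here,
    -- and `t = 0` is an arbitrary choice.
    let p : ∀ b, M b := fun b => Classical.arbitrary (M b)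
    let e' : ∀ b, OpenPartialHomeomorph (M b) (EuclideanSpace ℝ (Fin (n b))) :=
      Function.update (fun b => chartAt _ (p b)) a e
    let y' : ∀ b, EuclideanSpace ℝ (Fin (n b)) :=
      Function.update (fun b => extChartAt (𝓡 (n b)) (p b) (p b)) a y
    have he' : ∀ b, e' b ∈ atlas (EuclideanSpace ℝ (Fin (n b))) (M b) := by
      intro b
      by_cases hb : b = a
      · subst hb
        simpa [e'] using he
      · simp [e', hb]
    have hy' : ∀ b, y' b ∈ ((e' b).extend (𝓡 (n b))).target := by
      intro b
      by_cases hb : b = a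
      · subst hb
        simpa only [e', y', Function.update_self] using hy
      · simp only [e', y', Function.update_of_ne hb]
        exact mem_extChartAt_target (p b)
    have h := hF (EquiAffine.calabiChart e')
      (EquiAffine.mem_atlas_calabi_iff.mpr ⟨e', he', rfl⟩) (0, y')
      (EquiAffine.mem_calabiChart_target.mpr hy')
    rw [EquiAffine.calabi_comp_chart] at h
    have ha := (hlocal e' he' (0, y') hy').2.mp h a
    simpa only [e', y', Function.update_self] using ha
  · intro h
    refine ⟨⟨EquiAffine.contMDiff_calabiComposition fun a => (hx a).1.1, ?_⟩, ?_⟩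
    · intro E hE y hy
      obtain ⟨e, he, rfl⟩ := EquiAffine.mem_atlas_calabi_iff.mp hE
      rw [EquiAffine.calabi_comp_chart]
      exact (hlocal e he y (EquiAffine.mem_calabiChart_target.mp hy)).1
    · intro E hE y hy
      obtain ⟨e, he, rfl⟩ := EquiAffine.mem_atlas_calabi_iff.mp hE
      rw [EquiAffine.calabi_comp_chart]
      have hy' := EquiAffine.mem_calabiChart_target.mp hy
      exact (hlocal e he y hy').2.mpr fun a ε i j m l => (h a).2 (e a) (he a) _ (hy' a) ε i j m l
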